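/- Let $p$ be an odd prime, $t=\frac{p-1}{2}$, and let $w\ge 0$ be an integer. **Bars, cores, blocks.** A partition is $p$-strict if it has no repeated parts except possibly parts divisible by $p$. Removing a $p$-bar from a $p$-strict partition means replacing a part $b+p$ (with $b>0$) by $b$, where $b$ must not already be a part unless $p\mid b$; or deleting a part $p$; or deleting two parts whose sum is $p$. A $p$-bar core is a strict partition from which no $p$-bar can be removed. For a $p$-bar core $\rho$ and $1\le i\le t$ let $\ell_i$ be the number of parts congruent to $i$ or $p-i$ modulo $p$, and let $\epsilon_i=0$ if some part is congruent to $i$, $\epsilon_i=1$ otherwise; $c(\rho)=((\ell_1,\epsilon_1),\dots,(\ell_t,\epsilon_t))$ is the core $t$-tuple. The spin block labelled $\rho^w$ has rank $|\rho|+pw$, and a $p$-strict partition belongs to $\rho^w$ if removing $w$ successive $p$-bars from it gives $\rho$. **Allowed actions.** A $p$-strict partition $\lambda_1\ge\lambda_2\ge\dots$ (extended by zeros) is restricted if $\lambda_r-\lambda_{r+1}\le p$ for all $r$, with strict inequality when $p\mid\lambda_r$. Fill each row of a Young diagram with the residues $0,1,\dots,t-1,t,t-1,\dots,1,0$, repeated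 periodically from the first column. For $0\le i\le t$, a node $A$ of $\lambda$ is $i$-removable if it has residue $i$ and $\lambda\setminus\{A\}$ is $p$-strict, or if $A$ and the node $B$ immediately to its right both belong to $\lambda$ and have residue $i$, and $\lambda\setminus\{B\}$ and $\lambda\setminus\{A,B\}$ are $p$-strict. A node $B\notin\lambda$ is $i$-addable if it has residue $i$ and $\lambda\cup\{B\}$ is $p$-strict, or if the node $A$ immediately to its left is not in $\lambda$, both have residue $i$, and $\lambda\cup\{A\}$ and $\lambda\cup\{A,B\}$ are $p$-strict. Label addable nodes $+$ and removable nodes $-$, read the signs along the rim from bottom left to top right, and successively erase neighbouring pairs $+-$; in the resulting sequence the rightmost $-$ is the $i$-good node and the leftmost $+$ is the $i$-cogood node. Restricted $p$-strict partitions $\lambda,\mu$ are joined by an edge labelled $i$, going up from $\lambda$ to $\mu$, if $\mu$ arises from $\lambda$ by adding the $i$-cogood node or $\lambda$ arises from $\mu$ by removing the $i$-good node. The block-reduced crystal graph has the labels $\rho^w$ as vertices, with an edge labelled $i$ going up from one block to another whenever there is such an edge between some restricted partitions belonging to them. A block is external in its maximal $i$-string if no edge labelled $i$ goes up from it, or no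 edge labelled $i$ goes up to it. Let $K_i$ be the following involutions on $p$-strict partitions. For $0<i<t$, $K_i$ exchanges runners $i$ and $i+1$ and also runners $p-i$ and $p-i-1$ of the $p$-abacus; $K_t$ exchanges runners $t$ and $t+1$; and $K_0$ exchanges the parts $ap+1$ and $ap-1$ ($a>0$) and removes the part $1$ if it is present, and adds it if not. If $\rho^w$ is external in its maximal $i$-string, then passing from $\rho^w$ to $K_i(\rho)^w$ is called a $w$-allowed action. Say that $\rho^w$ *cannot be reduced* if no sequence of $w$-allowed actions leads from it to a block of lower rank, and that $\rho^w$ is *locally irreducible* if no single $w$-allowed action lowers its rank. (A block that cannot be reduced is locally irreducible.) **Proposition.** 1. If $\rho^w$ is locally irreducible (in particular, if it cannot be reduced) and $\rho\neq\emptyset$, then the minimum of the nonzero $\ell_i$ is at most $w$. 2. If $\rho^w$ is locally irreducible (in particular, if it cannot be reduced), and $m_1\le m_2\le\dots\le m_r$ are its nonzero $\ell_i$, sorted and with repetitions, then $m_{j+1}-m_j\le w-1$ for $1\le j<r$. 3. If $w\ge1$, there is a $p$-bar core $\rho_w$ with $c(\rho_w)=((w,0),(2w-1,0),\dots,(w+(w-1)(t-1),0))$;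 the block $\rho_w^w$ cannot be reduced; and every other locally irreducible block $\sigma^w$ (in particular, every other block $\sigma^w$ of weight $w$ that cannot be reduced) has rank strictly smaller than the rank of $\rho_w^w$. -/

import Mathlib

namespace SpinBlock

/-! ### Partitions, given by the multiset of their (positive) parts, and `p`-bars -/

/-- A `p`-strict partition: no part is repeated, except possibly parts divisible by `p`. -/
def IsPStrict (p : ℕ) (m : Multiset ℕ) : Prop :=
  0 ∉ m ∧ ∀ a ∈ m, ¬ p ∣ a → m.count a = 1

/-- A strict partition: the parts are distinct. -/
def IsStrict (m : Multiset ℕ) : Prop :=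
  0 ∉ m ∧ m.Nodup

/-- `m'` is obtained from the `p`-strict partition `m` by removing one `p`-bar: either a bead `b + p`
is lowered to `b` (which must be empty, unless the bead is on runner `0`, where several beads may
share a position), or a part `p` is removed, or two parts with sum `p` are removed. -/
def BarRemoval (p : ℕ) (m m' : Multiset ℕ) : Prop :=
  (∃ (b : ℕ) (n : Multiset ℕ), 0 < b ∧ (b ∉ n ∨ p ∣ b) ∧ m = (b + p) ::ₘ n ∧ m' = b ::ₘ n) ∨
  m = p ::ₘ m' ∨
  (∃ a b : ℕ, 0 < a ∧ 0 < b ∧ a + b = p ∧ m = a ::ₘ b ::ₘ m')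

/-- `BarRemovals p w m m'`: the partition `m'` is obtained from `m` by removing `w` successive
`p`-bars. -/
def BarRemovals (p : ℕ) : ℕ → Multiset ℕ → Multiset ℕ → Prop
  | 0, m, m' => m = m'
  | w + 1, m, m' => ∃ n, BarRemoval p m n ∧ BarRemovals p w n m'

/-- A `p`-bar core: a strict partition from which no `p`-bar can be removed. -/
def IsBarCore (p : ℕ) (ρ : Multiset ℕ) : Prop :=
  IsStrict ρ ∧ ∀ m, ¬ BarRemoval p ρ m

/-- The number `t = (p - 1) / 2`. -/
def tNum (p : ℕ) : ℕ := (p - 1) / 2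

/-- `ℓ_i`: the number of beads on runner `i` or runner `p - i`. -/
def coreLen (p : ℕ) (ρ : Multiset ℕ) (i : ℕ) : ℕ :=
  (ρ.filter fun a => a % p = i ∨ a % p = p - i).card

/-- `ε_i`: it is `0` if there are beads on runner `i`, and `1` otherwise. -/
def coreEps (p : ℕ) (ρ : Multiset ℕ) (i : ℕ) : ℕ :=
  if (ρ.filter fun a => a % p = i) = 0 then 1 else 0

/-- The core `t`-tuple `((ℓ_1, ε_1), …, (ℓ_t, ε_t))`; the entry at `j : Fin t` is the pair with
index `i = j + 1`. -/
def coreTuple (p : ℕ) (ρ : Multiset ℕ) : Fin (tNum p) → ℕ × ℕ :=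
  fun j => (coreLen p ρ (j + 1), coreEps p ρ (j + 1))

/-- The sequence `m_1 ≤ m_2 ≤ … ≤ m_r` of the nonzero `ℓ_i`, sorted, with repetitions. -/
def sortedLens (p : ℕ) (ρ : Multiset ℕ) : List ℕ :=
  (((Finset.univ : Finset (Fin (tNum p))).val.map fun j => (coreTuple p ρ j).1).filter
    fun l => l ≠ 0).sort (· ≤ ·)

/-- The rank of the block `ρ^w`, i.e. the `n` such that it is a spin block of the double cover of
the symmetric group `S_n`. -/
def blockRank (p : ℕ) (ρ : Multiset ℕ) (w : ℕ) : ℕ := ρ.sum + p * w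

/-! ### The involutions `K_i` -/

/-- The exchange of the beads `a p + 1` and `a p - 1`, `a > 0` (applied below to partitions
without the part `1`). -/
def swapZero (p a : ℕ) : ℕ :=
  if a % p = 1 then a - 2 else if a % p = p - 1 then a + 2 else a

/-- The exchange of runners `i` and `i + 1` and of runners `p - i` and `p - i - 1`
(for `i = t` this is the exchange of the runners `t` and `t + 1`). -/
def swapRunners (p i a : ℕ) : ℕ :=
  if a % p = i ∨ a % p = p - i - 1 then a + 1
  else if a % p = i + 1 ∨ a % p = p - i then a - 1
  else a

/-- The Scopes involutions `K_0, …, K_t`. -/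
def scopes (p i : ℕ) (m : Multiset ℕ) : Multiset ℕ :=
  if i = 0 then
    if 1 ∈ m then (m.erase 1).map (swapZero p) else 1 ::ₘ m.map (swapZero p)
  else m.map (swapRunners p i)

/-! ### The crystal graph on restricted `p`-strict partitions

Rows and columns of Young diagrams are numbered from `0`. -/

/-- The residue of the boxes in column `c`: the pattern is `0, 1, …, t - 1, t, t - 1, …, 1, 0`,
repeated. -/
def res (p c : ℕ) : ℕ :=
  if c % p ≤ tNum p then c % p else p - 1 - c % p

/-- The parts of the partition with Young diagram `lam`. -/
def parts (lam : YoungDiagram) : Multiset ℕ := (lam.rowLens : Multiset ℕ)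

/-- A finite set of boxes is the Young diagram of a `p`-strict partition. -/
def IsPStrictShape (p : ℕ) (s : Finset (ℕ × ℕ)) : Prop :=
  ∃ mu : YoungDiagram, mu.cells = s ∧ IsPStrict p (parts mu)

/-- A `p`-restricted (`p`-strict) partition: consecutive parts, including the last part and the
following zero, differ by at most `p`, and by less than `p` when the bigger one is divisible by
`p`. -/
def IsRestricted (p : ℕ) (lam : YoungDiagram) : Prop :=
  IsPStrict p (parts lam) ∧
  ∀ r, lam.rowLen r - lam.rowLen (r + 1) ≤ p ∧
    (p ∣ lam.rowLen r → lam.rowLen r - lam.rowLen (r + 1) ≠ p)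

/-- The node `A` of `lam` is `i`-removable. -/
def IsRemovable (p i : ℕ) (lam : YoungDiagram) (A : ℕ × ℕ) : Prop :=
  A ∈ lam ∧
  ((res p A.2 = i ∧ IsPStrictShape p (lam.cells \ {A})) ∨
   ((A.1, A.2 + 1) ∈ lam ∧ res p A.2 = i ∧ res p (A.2 + 1) = i ∧
      IsPStrictShape p (lam.cells \ {(A.1, A.2 + 1)}) ∧
      IsPStrictShape p (lam.cells \ {A, (A.1, A.2 + 1)})))

/-- The node `B` outside `lam` is `i`-addable. -/
def IsAddable (p i : ℕ) (lam : YoungDiagram) (B : ℕ × ℕ) : Prop :=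
  B ∉ lam ∧
  ((res p B.2 = i ∧ IsPStrictShape p (lam.cells ∪ {B})) ∨
   (∃ c, B.2 = c + 1 ∧ (B.1, c) ∉ lam ∧ res p c = i ∧ res p B.2 = i ∧
      IsPStrictShape p (lam.cells ∪ {(B.1, c)}) ∧
      IsPStrictShape p (lam.cells ∪ {(B.1, c), B})))

/-- A sign (`true` for `+`, `false` for `-`) together with the node that carries it. -/
abbrev SignedNode := Bool × (ℕ × ℕ)

/-- The order of nodes along the rim, from the bottom left to the top right. -/
def RimBefore (A B : ℕ × ℕ) : Prop :=
  B.1 < A.1 ∨ (A.1 = B.1 ∧ A.2 < B.2)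

/-- `S` is the `i`-signature of `lam`: the list of all `i`-addable nodes, labelled `+`, and all
`i`-removable nodes, labelled `-`, in the order in which they are met along the rim. -/
def IsSignature (p i : ℕ) (lam : YoungDiagram) (S : List SignedNode) : Prop :=
  S.Pairwise (fun x y => RimBefore x.2 y.2) ∧
  (∀ A, (true, A) ∈ S ↔ IsAddable p i lam A) ∧
  (∀ A, (false, A) ∈ S ↔ IsRemovable p i lam A)

/-- `S'` is obtained from `S` by erasing one neighbouring pair `+-`. -/
def ErasePair (S S' : List SignedNode) : Prop :=
  ∃ (u v : List SignedNode) (A B : ℕ × ℕ),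
    S = u ++ (true, A) :: (false, B) :: v ∧ S' = u ++ v

/-- `R` is the reduced `i`-signature of `lam`. -/
def IsReducedSignature (p i : ℕ) (lam : YoungDiagram) (R : List SignedNode) : Prop :=
  ∃ S, IsSignature p i lam S ∧ Relation.ReflTransGen ErasePair S R ∧ ∀ R', ¬ ErasePair R R'

/-- `A` is the `i`-good node of `lam`: it carries the rightmost `-` of the reduced signature. -/
def IsGood (p i : ℕ) (lam : YoungDiagram) (A : ℕ × ℕ) : Prop :=
  ∃ u v : List SignedNode, IsReducedSignature p i lam (u ++ (false, A) :: v) ∧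
    ∀ x ∈ v, x.1 = true

/-- `B` is the `i`-cogood node of `lam`: it carries the leftmost `+` of the reduced signature. -/
def IsCogood (p i : ℕ) (lam : YoungDiagram) (B : ℕ × ℕ) : Prop :=
  ∃ u v : List SignedNode, IsReducedSignature p i lam (u ++ (true, B) :: v) ∧
    ∀ x ∈ u, x.1 = false

/-- An edge of the crystal graph labelled `i`, from `lam` up to `mu`: one of the two restricted
partitions is obtained from the other by removing an `i`-good node or adding an `i`-cogood node. -/
def CrystalEdge (p i : ℕ) (lam mu : YoungDiagram) : Prop :=
  IsRestricted p lam ∧ IsRestricted p mu ∧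
  ((∃ B, IsCogood p i lam B ∧ mu.cells = lam.cells ∪ {B}) ∨
   (∃ A, IsGood p i mu A ∧ lam.cells = mu.cells \ {A}))

/-! ### The block-reduced crystal graph and allowed actions

The block with `p`-bar core `ρ` and weight `w` is labelled `ρ^w`, i.e. by the pair `(ρ, w)`. -/

/-- The restricted partition `lam` lies in the block `ρ^w`: removing `w` `p`-bars from it gives the
`p`-bar core `ρ`. -/
def InBlock (p : ℕ) (ρ : Multiset ℕ) (w : ℕ) (lam : YoungDiagram) : Prop :=
  IsBarCore p ρ ∧ IsRestricted p lam ∧ BarRemovals p w (parts lam) ρ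

/-- An edge labelled `i` of the block-reduced crystal graph, from `ρ^w` up to `σ^v`. -/
def BlockEdge (p i : ℕ) (ρ : Multiset ℕ) (w : ℕ) (σ : Multiset ℕ) (v : ℕ) : Prop :=
  ∃ lam mu, InBlock p ρ w lam ∧ InBlock p σ v mu ∧ CrystalEdge p i lam mu

/-- The block `ρ^w` is external in its maximal `i`-string, i.e. it is one of the ends of this
string: no edge labelled `i` leads up from it, or no edge labelled `i` leads up to it. -/
def IsExternal (p i : ℕ) (ρ : Multiset ℕ) (w : ℕ) : Prop :=
  (∀ σ v, ¬ BlockEdge p i ρ w σ v) ∨ (∀ σ v, ¬ BlockEdge p i σ v ρ w)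

/-- `σ^w` is obtained from `ρ^w` by one `w`-allowed action `K_i`, `0 ≤ i ≤ t`. -/
def AllowedAction (p w : ℕ) (ρ σ : Multiset ℕ) : Prop :=
  ∃ i, i ≤ tNum p ∧ IsExternal p i ρ w ∧ σ = scopes p i ρ

/-- The block `ρ^w` cannot be reduced by `w`-allowed actions: no sequence of `w`-allowed actions
leads from it to a block of lower rank. -/
def CannotBeReduced (p w : ℕ) (ρ : Multiset ℕ) : Prop :=
  ∀ σ, Relation.ReflTransGen (AllowedAction p w) ρ σ → blockRank p ρ w ≤ blockRank p σ w

/-- No single `w`-allowed action lowers the rank of the block `ρ^w`. -/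
def NoReducingAction (p w : ℕ) (ρ : Multiset ℕ) : Prop :=
  ∀ σ, AllowedAction p w ρ σ → blockRank p ρ w ≤ blockRank p σ w

/-- A block that cannot be reduced by any sequence of `w`-allowed actions is in particular not
reduced by a single one. -/
theorem CannotBeReduced.noReducingAction {p w : ℕ} {ρ : Multiset ℕ}
    (h : CannotBeReduced p w ρ) : NoReducingAction p w ρ :=
  fun σ hσ => h σ (Relation.ReflTransGen.single hσ)

end SpinBlock

namespace SpinBlock

/-! A partition is recorded by its charge x, where x_j is the number of parts congruent to j minus
the number congruent to -j modulo p, for 1 ≤ j ≤ t. Removing a p-bar does not change x, and x ↦ core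
is a bijection from ℤ^t to bar cores, with ℓ_j = |x_j| and ε_j = 0 exactly when x_j > 0. Twice the
size of the core is ∑ (2j x_j + p x_j (x_j - 1)). The K_i become affine reflections: K_0 sends x_1
to 1 - x_1, K_i swaps x_i and x_{i+1}, K_t negates x_t.

Adding a node of residue i changes x by a fixed vector (`bump`). Comparing ranks, the weight then
drops by a number L_i(x) (`edgeLoss`): x_1 for i = 0, x_{i+1} - x_i + 1 for 0 < i < t, and 2(1 -
x_t) for i = t. If L_i(x) > w there is no edge up, so the block is external. Hence a locally
irreducible block has x_1 ≤ w, ascents x_{i+1} - x_i at most w - 1 unless nonpositive, and x_t not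
too negative (`IsTame`). Claims 1 and 2 follow because a sequence with these bounds cannot jump over
a gap of length w in its absolute values (`IsTame.natAbs_le`).

In claim 3 the extremal charge is M_i = i(w-1) + 1. If every |x_i| ≥ w, or w = 1, tameness forces 0
≤ x_i ≤ M_i. Otherwise some |x_i| < w; by the gap bound the k-th smallest absolute value is at most
k(w-1) < M_k, and this deficit outweighs any gain from rearranging runners (`runnerBound_lt`).

That the extremal block is never reduced needs a converse: if i < t and L_i(x) = w, then the block
is not external. The neighbour above has weight 0, so it is a bare core, and removing two good nodes
from that core yields an edge into and an edge out of the block. Along any sequence of allowed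
actions one follows integers r_1 < ... < r_t, initially r_i = i, such that runner r_i mod p has
charge M_i + ⌊r_i/p⌋ (`IsConfiguration`). Only an action with L_i(x) = w could break their order or
positivity, and such an action is not allowed; so r_i ≥ i throughout. After completing the square
the rank is, up to constants, ∑ (2p M_i - p + 2 r_i)², which is smallest at r_i = i. -/

/-! ### Charges of multisets of parts -/

/-- The contribution of a bead `a` to the difference between runners `j` and `p - j`. -/
def beadSign (p j a : ℕ) : ℤ :=
  (if a % p = j then 1 else 0) - (if a % p = p - j then 1 else 0)

/-- The number of beads on runner `j` minus the number of beads on runner `p - j`. -/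
def charge (p : ℕ) (m : Multiset ℕ) (j : ℕ) : ℤ := (m.map (beadSign p j)).sum

@[simp] theorem charge_zero (p j : ℕ) : charge p 0 j = 0 := by simp [charge]

@[simp] theorem charge_cons (p a j : ℕ) (m : Multiset ℕ) :
    charge p (a ::ₘ m) j = beadSign p j a + charge p m j := by simp [charge]

theorem charge_add (p j : ℕ) (m n : Multiset ℕ) :
    charge p (m + n) j = charge p m j + charge p n j := by simp [charge]

theorem beadSign_sub {p j : ℕ} (hj : j ≤ p) (a : ℕ) :
    beadSign p (p - j) a = - beadSign p j a := by
  have : p - (p - j) = j := by omega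
  simp [beadSign, this]

theorem charge_sub {p j : ℕ} (hj : j ≤ p) (m : Multiset ℕ) :
    charge p m (p - j) = - charge p m j := by
  induction m using Multiset.induction_on with
  | empty => simp
  | cons a m ih => rw [charge_cons, charge_cons, ih, beadSign_sub hj]; ring

theorem beadSign_add_self (p j a : ℕ) : beadSign p j (a + p) = beadSign p j a := by
  simp [beadSign]

theorem beadSign_eq_zero {p j a : ℕ} (hj : 0 < j) (hjp : j < p) (ha : p ∣ a) :
    beadSign p j a = 0 := by
  have h : a % p = 0 := Nat.mod_eq_zero_of_dvd ha
  have h1 : ¬ 0 = j := by omega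
  have h2 : ¬ 0 = p - j := by omega
  simp [beadSign, h, h1, h2]

theorem charge_eq_card (p j : ℕ) (m : Multiset ℕ) :
    charge p m j = ((m.filter fun a => a % p = j).card : ℤ)
      - ((m.filter fun a => a % p = p - j).card : ℤ) := by
  induction m using Multiset.induction_on with
  | empty => simp
  | cons a m ih =>
    rw [charge_cons, ih, beadSign, Multiset.filter_cons, Multiset.filter_cons]
    split_ifs <;> simp <;> ring

/-! ### Bar removal -/

/-- Lowering a bead by p keeps its runner, a part p lies on runner 0, and two parts with sum p lie
on opposite runners and cancel. -/
theorem BarRemoval.charge_eq {p : ℕ} {m m' : Multiset ℕ} (h : BarRemoval p m m') {j : ℕ}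
    (hj : 0 < j) (hjp : j < p) : charge p m j = charge p m' j := by
  rcases h with ⟨b, n, -, -, rfl, rfl⟩ | rfl | ⟨a, b, ha, hb, hab, rfl⟩
  · simp [beadSign_add_self]
  · simp [beadSign_eq_zero hj hjp]
  · have h1 : a % p = a := Nat.mod_eq_of_lt (by omega)
    have h2 : b % p = b := Nat.mod_eq_of_lt (by omega)
    simp only [charge_cons, beadSign, h1, h2]
    have e1 : (a = j) ↔ (b = p - j) := by omega
    have e2 : (a = p - j) ↔ (b = j) := by omega
    simp only [e1, e2]
    ring

theorem BarRemoval.sum_eq {p : ℕ} {m m' : Multiset ℕ} (h : BarRemoval p m m') :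
    m.sum = m'.sum + p := by
  rcases h with ⟨b, n, -, -, rfl, rfl⟩ | rfl | ⟨a, b, ha, hb, hab, rfl⟩ <;> simp <;> omega

theorem isPStrict_of_cons {p a : ℕ} {m : Multiset ℕ} (h : IsPStrict p (a ::ₘ m)) :
    IsPStrict p m := by
  refine ⟨fun h0 => h.1 (Multiset.mem_cons_of_mem h0), fun b hb hpb => ?_⟩
  have h1 := h.2 b (Multiset.mem_cons_of_mem hb) hpb
  have h2 := Multiset.count_le_count_cons b a m
  have h3 := Multiset.count_pos.2 hb
  omega

theorem isPStrict_cons {p a : ℕ} {m : Multiset ℕ} (h : IsPStrict p m) (ha : 0 < a)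
    (ham : a ∉ m ∨ p ∣ a) : IsPStrict p (a ::ₘ m) := by
  refine ⟨fun h0 => ?_, fun b hb hpb => ?_⟩
  · rcases Multiset.mem_cons.1 h0 with h0 | h0
    · omega
    · exact h.1 h0
  · by_cases hba : b = a
    · subst hba
      have : b ∉ m := by tauto
      simp [Multiset.count_eq_zero_of_notMem this]
    · rw [Multiset.count_cons_of_ne hba]
      exact h.2 b ((Multiset.mem_cons.1 hb).resolve_left hba) hpb

theorem BarRemoval.isPStrict {p : ℕ} {m m' : Multiset ℕ} (h : BarRemoval p m m')
    (hm : IsPStrict p m) : IsPStrict p m' := by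
  rcases h with ⟨b, n, hb, hbn, rfl, rfl⟩ | rfl | ⟨a, b, ha, hb, hab, rfl⟩
  · exact isPStrict_cons (isPStrict_of_cons hm) hb hbn
  · exact isPStrict_of_cons hm
  · exact isPStrict_of_cons (isPStrict_of_cons hm)

theorem BarRemovals.charge_eq {p : ℕ} {j : ℕ} (hj : 0 < j) (hjp : j < p) {w : ℕ} :
    ∀ {m m' : Multiset ℕ}, BarRemovals p w m m' → charge p m j = charge p m' j := by
  induction w with
  | zero => rintro m m' rfl; rfl
  | succ w ih =>
    rintro m m' ⟨n, h1, h2⟩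
    rw [h1.charge_eq hj hjp, ih h2]

theorem BarRemovals.sum_eq {p : ℕ} {w : ℕ} :
    ∀ {m m' : Multiset ℕ}, BarRemovals p w m m' → m.sum = m'.sum + p * w := by
  induction w with
  | zero => rintro m m' rfl; simp
  | succ w ih =>
    rintro m m' ⟨n, h1, h2⟩
    rw [h1.sum_eq, ih h2]; ring

/-- A repeated part must be a multiple of p. If it is p it can be deleted; otherwise it can be
lowered by p, since positions on runner 0 may be shared. -/
theorem isStrict_of_forall_not_barRemoval {p : ℕ} (hp : 0 < p) {m : Multiset ℕ}
    (hm : IsPStrict p m) (h : ∀ m', ¬ BarRemoval p m m') : IsStrict m := by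
  refine ⟨hm.1, Multiset.nodup_iff_count_le_one.2 fun a => ?_⟩
  by_contra! hc
  have ha : a ∈ m := Multiset.count_pos.1 (by omega)
  have hpa : p ∣ a := by
    by_contra hpa
    have := hm.2 a ha hpa
    omega
  obtain ⟨k, rfl⟩ := hpa
  obtain ⟨n, rfl⟩ := Multiset.exists_cons_of_mem ha
  rcases k with _ | _ | k
  · exact hm.1 (by simp)
  · exact h n (Or.inr (Or.inl (by simp)))
  · refine h (p * (k + 1) ::ₘ n) (Or.inl ⟨p * (k + 1), n, by positivity, ?_, ?_, rfl⟩)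
    · exact Or.inr (dvd_mul_right _ _)
    · congr 1

/-- Each removal lowers the sum by p, so the process stops. Which core is reached will be read off
from the charge, so no confluence argument is needed. -/
theorem exists_barRemovals {p : ℕ} (hp : 0 < p) (m : Multiset ℕ) (hm : IsPStrict p m) :
    ∃ w ρ, IsBarCore p ρ ∧ BarRemovals p w m ρ := by
  induction hn : m.sum using Nat.strong_induction_on generalizing m with
  | _ n ih =>
    by_cases h : ∃ m', BarRemoval p m m'
    · obtain ⟨m', h'⟩ := h
      have := h'.sum_eq
      obtain ⟨w, ρ, h1, h2⟩ := ih m'.sum (by omega) m' (h'.isPStrict hm) rfl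
      exact ⟨w + 1, ρ, h1, m', h', h2⟩
    · push Not at h
      exact ⟨0, m, ⟨isStrict_of_forall_not_barRemoval hp hm h, h⟩, rfl⟩

/-! ### Bar cores and charges -/

theorem IsBarCore.pos {p : ℕ} {ρ : Multiset ℕ} (h : IsBarCore p ρ) {a : ℕ} (ha : a ∈ ρ) :
    0 < a :=
  Nat.pos_of_ne_zero fun h0 => h.1.1 (h0 ▸ ha)

theorem IsBarCore.isPStrict {p : ℕ} {ρ : Multiset ℕ} (h : IsBarCore p ρ) : IsPStrict p ρ :=
  ⟨h.1.1, fun _ ha _ => Multiset.count_eq_one_of_mem h.1.2 ha⟩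

theorem IsBarCore.mem_of_add_mem {p : ℕ} {ρ : Multiset ℕ} (h : IsBarCore p ρ) {a : ℕ}
    (ha0 : 0 < a) (ha : a + p ∈ ρ) : a ∈ ρ := by
  by_contra hc
  obtain ⟨n, rfl⟩ := Multiset.exists_cons_of_mem ha
  exact h.2 (a ::ₘ n) (Or.inl ⟨a, n, ha0, Or.inl fun hn => hc (Multiset.mem_cons_of_mem hn),
    rfl, rfl⟩)

theorem IsBarCore.not_dvd {p : ℕ} {ρ : Multiset ℕ} (h : IsBarCore p ρ) {a : ℕ}
    (ha : a ∈ ρ) : ¬ p ∣ a := by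
  rintro ⟨k, rfl⟩
  have hpos := h.pos ha
  induction k with
  | zero => simp at hpos
  | succ k ih =>
    rcases Nat.eq_zero_or_pos k with rfl | hk
    · obtain ⟨n, hn⟩ := Multiset.exists_cons_of_mem ha
      exact h.2 n (Or.inr (Or.inl (by simpa using hn)))
    · have hpk : 0 < p * k := Nat.mul_pos (Nat.pos_of_mul_pos_right hpos) hk
      exact ih (h.mem_of_add_mem hpk (by simpa [mul_add] using ha)) hpk

theorem IsBarCore.add_ne {p : ℕ} (hp : Odd p) {ρ : Multiset ℕ} (h : IsBarCore p ρ) {a b : ℕ}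
    (ha : a ∈ ρ) (hb : b ∈ ρ) : a + b ≠ p := by
  intro hab
  have ha0 := h.pos ha
  have hb0 := h.pos hb
  obtain ⟨n, rfl⟩ := Multiset.exists_cons_of_mem ha
  rcases Multiset.mem_cons.1 hb with rfl | hbn
  · obtain ⟨k, hk⟩ := hp
    omega
  · obtain ⟨n', rfl⟩ := Multiset.exists_cons_of_mem hbn
    exact h.2 n' (Or.inr (Or.inr ⟨a, b, ha0, hb0, hab, rfl⟩))

theorem IsBarCore.mem_of_add_mul_mem {p : ℕ} {ρ : Multiset ℕ} (h : IsBarCore p ρ) {r k l : ℕ}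
    (hr : 0 < r) (hkl : k ≤ l) (ha : r + p * l ∈ ρ) : r + p * k ∈ ρ := by
  induction l with
  | zero => simpa [Nat.le_zero.1 hkl] using ha
  | succ l ih =>
    rcases Nat.lt_or_ge l k with hlk | hlk
    · rwa [show k = l + 1 by omega]
    · exact ih hlk (h.mem_of_add_mem (by omega) (by rwa [mul_add, mul_one, ← add_assoc] at ha))

theorem add_mul_mod {p r : ℕ} (hr : r < p) (k : ℕ) : (r + p * k) % p = r := by
  rw [Nat.add_mul_mod_self_left, Nat.mod_eq_of_lt hr]

theorem add_mul_div {p r : ℕ} (hr : r < p) (k : ℕ) : (r + p * k) / p = k := by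
  rw [Nat.add_mul_div_left _ _ (by omega), Nat.div_eq_of_lt hr, zero_add]

theorem mem_iff_lt_card_of_isLowerSet {s : Finset ℕ} (h : ∀ k l, k ≤ l → l ∈ s → k ∈ s) (k : ℕ) :
    k ∈ s ↔ k < s.card := by
  constructor
  · intro hk
    have : Finset.range (k + 1) ⊆ s := fun l hl =>
      h l k (by simpa [Nat.lt_succ_iff] using hl) hk
    simpa using Finset.card_le_card this
  · intro hk
    by_contra hc
    have : s ⊆ Finset.range k := fun l hl => by
      rw [Finset.mem_range]
      by_contra! hkl
      exact hc (h k l hkl hl)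
    have := Finset.card_le_card this
    simp at this
    omega

/-- The beads on a runner of a bar core occupy the lowest positions. -/
theorem IsBarCore.mem_iff_lt_card {p : ℕ} {ρ : Multiset ℕ} (h : IsBarCore p ρ) {r : ℕ}
    (hr : 0 < r) (hrp : r < p) (k : ℕ) :
    r + p * k ∈ ρ ↔ k < (ρ.filter fun a => a % p = r).card := by
  set s : Finset ℕ := ((ρ.filter fun a => a % p = r).map (· / p)).toFinset with hs
  have hmem : ∀ k, k ∈ s ↔ r + p * k ∈ ρ := by
    intro k
    simp only [hs, Multiset.mem_toFinset, Multiset.mem_map, Multiset.mem_filter]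
    constructor
    · rintro ⟨a, ⟨ha, har⟩, rfl⟩
      rwa [← har, Nat.mod_add_div]
    · intro hk
      exact ⟨_, ⟨hk, add_mul_mod hrp k⟩, add_mul_div hrp k⟩
  have hcard : s.card = (ρ.filter fun a => a % p = r).card := by
    rw [hs, Multiset.toFinset_card_of_nodup, Multiset.card_map]
    refine Multiset.Nodup.map_on ?_ (h.1.2.filter _)
    intro a ha b hb hab
    have h1 := (Multiset.mem_filter.1 ha).2
    have h2 := (Multiset.mem_filter.1 hb).2
    rw [← Nat.mod_add_div a p, ← Nat.mod_add_div b p, h1, h2, hab]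
  rw [← hmem, ← hcard]
  refine mem_iff_lt_card_of_isLowerSet (fun k l hkl hl => ?_) k
  rw [hmem] at hl ⊢
  exact h.mem_of_add_mul_mem hr hkl hl

/-- Runners r and p - r cannot both be occupied: their lowest beads would be r and p - r, with sum
p. So one of the two counts in the charge vanishes. -/
theorem IsBarCore.card_filter {p : ℕ} (hp : Odd p) {ρ : Multiset ℕ} (h : IsBarCore p ρ) {r : ℕ}
    (hr : 0 < r) (hrp : r < p) :
    (ρ.filter fun a => a % p = r).card = (charge p ρ r).toNat := by
  have h1 := h.mem_iff_lt_card hr hrp 0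
  have h2 := h.mem_iff_lt_card (r := p - r) (by omega) (by omega) 0
  have h3 := charge_eq_card p r ρ
  have h4 : r ∈ ρ → p - r ∉ ρ := fun h1 h2 => h.add_ne hp h1 h2 (by omega)
  simp only [mul_zero, add_zero] at h1 h2
  rw [h1, h2] at h4
  omega

theorem IsBarCore.mem_iff {p : ℕ} (hp : Odd p) {ρ : Multiset ℕ} (h : IsBarCore p ρ) {a : ℕ} :
    a ∈ ρ ↔ ¬ p ∣ a ∧ ((a / p : ℕ) : ℤ) < charge p ρ (a % p) := by
  by_cases hpa : p ∣ a
  · exact ⟨fun ha => absurd hpa (h.not_dvd ha), fun ha => absurd hpa ha.1⟩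
  · have hp0 : 0 < p := hp.pos
    have hr : 0 < a % p := Nat.pos_of_ne_zero fun h0 => hpa (Nat.dvd_of_mod_eq_zero h0)
    have := h.mem_iff_lt_card hr (Nat.mod_lt a hp0) (a / p)
    rw [Nat.mod_add_div, h.card_filter hp hr (Nat.mod_lt a hp0)] at this
    rw [this]
    simp only [hpa, not_false_eq_true, true_and]
    generalize a / p = k
    omega

/-! ### Bar cores and antisymmetric functions on residues -/

/-- The function `x` on residues is antisymmetric. -/
def IsAntisymm (p : ℕ) (x : ℕ → ℤ) : Prop := ∀ r, 0 < r → r < p → x (p - r) = - x r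

theorem isAntisymm_charge (p : ℕ) (m : Multiset ℕ) : IsAntisymm p (charge p m) :=
  fun _ _ hr => charge_sub hr.le m

/-- The beads of the abacus described by `x` are at the positions `a` with `a / p < x (a % p)`. -/
def IsAbacus (p : ℕ) (x : ℕ → ℤ) (ρ : Multiset ℕ) : Prop :=
  ρ.Nodup ∧ ∀ a, a ∈ ρ ↔ ¬ p ∣ a ∧ ((a / p : ℕ) : ℤ) < x (a % p)

theorem IsBarCore.isAbacus {p : ℕ} (hp : Odd p) {ρ : Multiset ℕ} (h : IsBarCore p ρ) :
    IsAbacus p (charge p ρ) ρ :=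
  ⟨h.1.2, fun _ => h.mem_iff hp⟩

theorem IsAbacus.mem_add_mul {p : ℕ} {x : ℕ → ℤ} {ρ : Multiset ℕ} (h : IsAbacus p x ρ) {r : ℕ}
    (hr : 0 < r) (hrp : r < p) (k : ℕ) : r + p * k ∈ ρ ↔ (k : ℤ) < x r := by
  rw [h.2, add_mul_mod hrp, add_mul_div hrp, Nat.dvd_iff_mod_eq_zero, add_mul_mod hrp]
  have : r ≠ 0 := by omega
  simp [this]

theorem mod_pos_of_not_dvd {p a : ℕ} (h : ¬ p ∣ a) : 0 < a % p :=
  Nat.pos_of_ne_zero fun h0 => h (Nat.dvd_of_mod_eq_zero h0)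

/-- Runners are filled from the bottom, so no bead can be lowered; x a and x (p - a) = -x a are not
both positive, so no two beads have sum p. -/
theorem IsAbacus.isBarCore {p : ℕ} {x : ℕ → ℤ} {ρ : Multiset ℕ} (hp : 0 < p)
    (h : IsAbacus p x ρ) (hx : IsAntisymm p x) : IsBarCore p ρ := by
  refine ⟨⟨fun h0 => ((h.2 0).1 h0).1 (dvd_zero p), h.1⟩, ?_⟩
  rintro m (⟨b, n, hb, hbn, rfl, rfl⟩ | rfl | ⟨a, b, ha, hb, hab, rfl⟩)
  · have h1 := (h.2 (b + p)).1 (Multiset.mem_cons_self _ _)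
    have hpb : ¬ p ∣ b := fun h' => h1.1 (by simpa using h')
    have hb' : b ∈ (b + p) ::ₘ n := by
      rw [h.2]
      refine ⟨hpb, ?_⟩
      have h2 := h1.2
      rw [Nat.add_mod_right, Nat.add_div_right _ hp] at h2
      push_cast at h2 ⊢
      omega
    rcases Multiset.mem_cons.1 hb' with h' | h'
    · omega
    · tauto
  · exact ((h.2 p).1 (Multiset.mem_cons_self _ _)).1 dvd_rfl
  · have h1 := ((h.2 a).1 (Multiset.mem_cons_self _ _)).2
    have h2 := ((h.2 b).1 (Multiset.mem_cons_of_mem (Multiset.mem_cons_self _ _))).2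
    have h3 := hx a ha (by omega)
    rw [Nat.div_eq_of_lt (by omega), Nat.mod_eq_of_lt (by omega)] at h1 h2
    rw [show p - a = b by omega] at h3
    omega

theorem IsAbacus.filter_eq {p : ℕ} {x : ℕ → ℤ} {ρ : Multiset ℕ} (h : IsAbacus p x ρ) {r : ℕ}
    (hr : 0 < r) (hrp : r < p) :
    (ρ.filter fun a => a % p = r) =
      (Multiset.range (x r).toNat).map fun k => r + p * k := by
  refine (Multiset.Nodup.ext (h.1.filter _) ?_).2 fun a => ?_
  · refine Multiset.Nodup.map_on (fun k _ l _ hkl => ?_) (Multiset.nodup_range _)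
    have h1 := add_mul_div hrp k
    rw [hkl, add_mul_div hrp] at h1
    exact h1.symm
  · simp only [Multiset.mem_filter, Multiset.mem_map, Multiset.mem_range]
    constructor
    · rintro ⟨ha, har⟩
      refine ⟨a / p, ?_, by rw [← har, Nat.mod_add_div]⟩
      have := ((h.2 a).1 ha).2
      rw [har] at this
      omega
    · rintro ⟨k, hk, rfl⟩
      exact ⟨(h.mem_add_mul hr hrp k).2 (by omega), add_mul_mod hrp k⟩

theorem IsAbacus.charge_eq {p : ℕ} {x : ℕ → ℤ} {ρ : Multiset ℕ}
    (h : IsAbacus p x ρ) (hx : IsAntisymm p x) {r : ℕ} (hr : 0 < r) (hrp : r < p) :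
    charge p ρ r = x r := by
  rw [charge_eq_card, h.filter_eq hr hrp, h.filter_eq (r := p - r) (by omega) (by omega),
    hx r hr hrp]
  simp only [Multiset.card_map, Multiset.card_range]
  omega

theorem exists_isAbacus (p : ℕ) (hp : 0 < p) (x : ℕ → ℤ) : ∃ ρ, IsAbacus p x ρ := by
  obtain ⟨N, hN⟩ : ∃ N : ℕ, ∀ r < p, x r ≤ N := by
    refine ⟨∑ r ∈ Finset.range p, (x r).toNat, fun r hr => ?_⟩
    have := Finset.single_le_sum (f := fun r => (x r).toNat) (fun _ _ => Nat.zero_le _)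
      (Finset.mem_range.2 hr)
    omega
  refine ⟨((Finset.range (p * N)).filter fun a =>
    ¬ p ∣ a ∧ ((a / p : ℕ) : ℤ) < x (a % p)).val, Finset.nodup _, fun a => ?_⟩
  simp only [Finset.mem_val, Finset.mem_filter, Finset.mem_range, and_iff_right_iff_imp]
  rintro ⟨-, h⟩
  have := hN (a % p) (Nat.mod_lt a hp)
  exact (Nat.div_lt_iff_lt_mul hp).1 (by omega) |>.trans_eq (mul_comm _ _)

theorem IsAbacus.eq_of_charge_eq {p : ℕ} {x y : ℕ → ℤ} {ρ σ : Multiset ℕ} (hp : 0 < p)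
    (h : IsAbacus p x ρ) (h' : IsAbacus p y σ) (hxy : ∀ r, 0 < r → r < p → x r = y r) :
    ρ = σ := by
  refine (Multiset.Nodup.ext h.1 h'.1).2 fun a => ?_
  rw [h.2, h'.2]
  refine and_congr_right fun ha => ?_
  rw [hxy _ (mod_pos_of_not_dvd ha) (Nat.mod_lt a hp)]

theorem tNum_of_odd {p : ℕ} (hp : Odd p) : p = 2 * tNum p + 1 := by
  obtain ⟨k, rfl⟩ := hp
  simp [tNum]

theorem IsAntisymm.ext {p : ℕ} (hp : Odd p) {x y : ℕ → ℤ} (hx : IsAntisymm p x)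
    (hy : IsAntisymm p y) (h : ∀ j, 0 < j → j ≤ tNum p → x j = y j) {r : ℕ} (hr : 0 < r)
    (hrp : r < p) : x r = y r := by
  have hpt := tNum_of_odd hp
  by_cases hrt : r ≤ tNum p
  · exact h r hr hrt
  · have h1 := hx r hr hrp
    have h2 := hy r hr hrp
    rw [h (p - r) (by omega) (by omega)] at h1
    omega

theorem IsBarCore.eq_of_charge_eq {p : ℕ} (hp : Odd p) {ρ σ : Multiset ℕ} (h : IsBarCore p ρ)
    (h' : IsBarCore p σ) (hxy : ∀ j, 0 < j → j ≤ tNum p → charge p ρ j = charge p σ j) : ρ = σ :=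
  (h.isAbacus hp).eq_of_charge_eq hp.pos (h'.isAbacus hp) fun _ hr hrp =>
    (isAntisymm_charge p ρ).ext hp (isAntisymm_charge p σ) hxy hr hrp

/-! ### The rank of a core as a quadratic function of its charge -/

/-- Twice the sum of the beads on runners `j` and `p - j` of a bar core with charge `z` at `j`. -/
def runnerRank (p j : ℕ) (z : ℤ) : ℤ := 2 * j * z + p * (z * (z - 1))

theorem two_mul_sum_range_add_mul (r p n : ℕ) :
    2 * (((Multiset.range n).map fun k => r + p * k).sum : ℤ) = 2 * r * n + p * (n * (n - 1)) := by
  induction n with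
  | zero => simp
  | succ n ih =>
    rw [Multiset.range_succ, Multiset.map_cons, Multiset.sum_cons]
    push_cast at ih ⊢
    rw [mul_add, ih]
    ring

/-- Only one of the two runners is occupied. One polynomial serves both signs: for z < 0 the beads
are p - j + p k with k < -z, and twice their sum is again 2 j z + p z (z - 1). -/
theorem IsAbacus.two_mul_sum_filter {p : ℕ} {x : ℕ → ℤ} {ρ : Multiset ℕ}
    (h : IsAbacus p x ρ) (hx : IsAntisymm p x) (j : ℕ) (hj : 0 < j) (hjp : 2 * j < p) :
    2 * ((ρ.filter fun a => min (a % p) (p - a % p) = j).sum : ℤ) = runnerRank p j (x j) := by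
  have hsplit : (ρ.filter fun a => min (a % p) (p - a % p) = j) =
      (ρ.filter fun a => a % p = j) + (ρ.filter fun a => a % p = p - j) := by
    rw [Multiset.filter_add_filter]
    have : (ρ.filter fun a => a % p = j ∧ a % p = p - j) = 0 := by
      rw [Multiset.filter_eq_nil]
      rintro a - ⟨h1, h2⟩
      omega
    rw [this, add_zero]
    refine Multiset.filter_congr fun a _ => ?_
    have := Nat.mod_lt a (show 0 < p by omega)
    omega
  rw [hsplit, Multiset.sum_add, h.filter_eq hj (by omega),
    h.filter_eq (r := p - j) (by omega) (by omega), hx j hj (by omega)]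
  rw [Nat.cast_add, mul_add, two_mul_sum_range_add_mul, two_mul_sum_range_add_mul, runnerRank]
  rcases le_total 0 (x j) with h0 | h0
  · rw [show (-x j).toNat = 0 by omega, Int.toNat_of_nonneg h0]
    simp
  · rw [show (x j).toNat = 0 by omega, Int.toNat_of_nonneg (by omega : 0 ≤ - x j)]
    push_cast [show j ≤ p by omega]
    ring

/-- The beads are grouped by `min (a % p) (p - a % p)`, the common index of the runner pair {j, p -
j}. -/
theorem IsAbacus.two_mul_sum {p : ℕ} (hp : Odd p) {x : ℕ → ℤ} {ρ : Multiset ℕ}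
    (h : IsAbacus p x ρ) (hx : IsAntisymm p x) :
    2 * (ρ.sum : ℤ) = ∑ j ∈ Finset.Icc 1 (tNum p), runnerRank p j (x j) := by
  have hpt := tNum_of_odd hp
  have key : ρ.sum = ∑ j ∈ Finset.Icc 1 (tNum p),
      (ρ.filter fun a => min (a % p) (p - a % p) = j).sum := by
    have := Finset.sum_fiberwise_of_maps_to (s := ρ.toFinset) (t := Finset.Icc 1 (tNum p))
      (g := fun a => min (a % p) (p - a % p)) (f := fun a => a) (fun a ha => by
        have h1 := mod_pos_of_not_dvd ((h.2 a).1 (Multiset.mem_toFinset.1 ha)).1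
        have h2 := Nat.mod_lt a hp.pos
        simp only [Finset.mem_Icc]
        omega)
    have h1 : ρ.sum = ∑ a ∈ ρ.toFinset, a := by
      rw [Finset.sum_eq_multiset_sum, Multiset.toFinset_val, h.1.dedup, Multiset.map_id']
    rw [h1, ← this]
    refine Finset.sum_congr rfl fun j _ => ?_
    rw [Finset.sum_eq_multiset_sum, Finset.filter_val, Multiset.toFinset_val, h.1.dedup,
      Multiset.map_id']
  rw [key, Nat.cast_sum, Finset.mul_sum]
  refine Finset.sum_congr rfl fun j hj => ?_
  rw [Finset.mem_Icc] at hj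
  exact h.two_mul_sum_filter hx j (by omega) (by omega)

theorem IsBarCore.two_mul_sum {p : ℕ} (hp : Odd p) {ρ : Multiset ℕ} (h : IsBarCore p ρ) :
    2 * (ρ.sum : ℤ) = ∑ j ∈ Finset.Icc 1 (tNum p), runnerRank p j (charge p ρ j) :=
  (h.isAbacus hp).two_mul_sum hp (isAntisymm_charge p ρ)

/-! ### The Scopes involutions on bar cores -/

section Swap

variable {p i : ℕ}

theorem swapRunners_add_mul {r : ℕ} (hr : r < p) (hi0 : 0 < i) (k : ℕ) :
    swapRunners p i (r + p * k) = swapRunners p i r + p * k := by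
  simp only [swapRunners, add_mul_mod hr, Nat.mod_eq_of_lt hr]
  split_ifs <;> omega

/-- A case table without truncated subtraction, from which linear arithmetic gives the properties of
the involution. For i = t the two exchanged pairs of runners coincide. -/
theorem swapRunners_cases {r : ℕ} (hr : r < p) (hi : 2 * i < p ∧ p % 2 = 1) :
    (r = i ∨ r + i + 1 = p) ∧ swapRunners p i r = r + 1 ∨
    r ≠ i ∧ r + i + 1 ≠ p ∧ (r = i + 1 ∨ r + i = p) ∧ swapRunners p i r + 1 = r ∨
    r ≠ i ∧ r + i + 1 ≠ p ∧ r ≠ i + 1 ∧ r + i ≠ p ∧ swapRunners p i r = r := by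
  have e1 : r = p - i - 1 ↔ r + i + 1 = p := by omega
  have e2 : r = p - i ↔ r + i = p := by omega
  simp only [swapRunners, Nat.mod_eq_of_lt hr, e1, e2]
  split_ifs <;> omega

theorem swapRunners_lt {r : ℕ} (hr : r < p) (hi0 : 0 < i) (hi : 2 * i < p ∧ p % 2 = 1) :
    swapRunners p i r < p := by
  have := swapRunners_cases hr hi
  omega

theorem swapRunners_swapRunners_of_lt {r : ℕ} (hr : r < p) (hi0 : 0 < i)
    (hi : 2 * i < p ∧ p % 2 = 1) :
    swapRunners p i (swapRunners p i r) = r := by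
  have h1 := swapRunners_cases hr hi
  have h2 := swapRunners_cases (swapRunners_lt hr hi0 hi) hi
  omega

theorem swapRunners_sub {r : ℕ} (hr0 : 0 < r) (hr : r < p) (hi : 2 * i < p ∧ p % 2 = 1) :
    swapRunners p i (p - r) = p - swapRunners p i r := by
  have h1 := swapRunners_cases hr hi
  have h2 := swapRunners_cases (show p - r < p by omega) hi
  omega

theorem swapRunners_pos {r : ℕ} (hr0 : 0 < r) (hr : r < p) (hi0 : 0 < i)
    (hi : 2 * i < p ∧ p % 2 = 1) :
    0 < swapRunners p i r := by
  have := swapRunners_cases hr hi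
  omega

theorem swapRunners_mod (hi0 : 0 < i) (hi : 2 * i < p ∧ p % 2 = 1) (a : ℕ) :
    swapRunners p i a % p = swapRunners p i (a % p) := by
  have hr := Nat.mod_lt a (show 0 < p by omega)
  conv_lhs => rw [← Nat.mod_add_div a p, swapRunners_add_mul hr hi0,
    add_mul_mod (swapRunners_lt hr hi0 hi)]

theorem swapRunners_div (hi0 : 0 < i) (hi : 2 * i < p ∧ p % 2 = 1) (a : ℕ) :
    swapRunners p i a / p = a / p := by
  have hr := Nat.mod_lt a (show 0 < p by omega)
  conv_lhs => rw [← Nat.mod_add_div a p, swapRunners_add_mul hr hi0,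
    add_mul_div (swapRunners_lt hr hi0 hi)]

theorem swapRunners_swapRunners (hi0 : 0 < i) (hi : 2 * i < p ∧ p % 2 = 1) (a : ℕ) :
    swapRunners p i (swapRunners p i a) = a := by
  have hr := Nat.mod_lt a (show 0 < p by omega)
  rw [← Nat.mod_add_div a p, swapRunners_add_mul hr hi0,
    swapRunners_add_mul (swapRunners_lt hr hi0 hi) hi0, swapRunners_swapRunners_of_lt hr hi0 hi]

theorem dvd_swapRunners (hi0 : 0 < i) (hi : 2 * i < p ∧ p % 2 = 1) (a : ℕ) :
    p ∣ swapRunners p i a ↔ p ∣ a := by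
  have hr := Nat.mod_lt a (show 0 < p by omega)
  rw [Nat.dvd_iff_mod_eq_zero, Nat.dvd_iff_mod_eq_zero, swapRunners_mod hi0 hi]
  constructor
  · intro h
    by_contra h0
    exact (swapRunners_pos (Nat.pos_of_ne_zero h0) hr hi0 hi).ne' h
  · intro h
    rw [h, swapRunners, Nat.zero_mod, if_neg (by omega), if_neg (by omega)]

theorem IsAbacus.map_swapRunners (hi0 : 0 < i) (hi : 2 * i < p ∧ p % 2 = 1)
    {x : ℕ → ℤ} {ρ : Multiset ℕ}
    (h : IsAbacus p x ρ) :
    IsAbacus p (fun r => x (swapRunners p i r)) (ρ.map (swapRunners p i)) := by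
  have hinv := swapRunners_swapRunners hi0 hi
  refine ⟨h.1.map (Function.LeftInverse.injective hinv), fun a => ?_⟩
  have h1 : a ∈ ρ.map (swapRunners p i) ↔ swapRunners p i a ∈ ρ := by
    rw [Multiset.mem_map]
    constructor
    · rintro ⟨b, hb, rfl⟩
      rwa [hinv]
    · exact fun ha => ⟨_, ha, hinv a⟩
  rw [h1, h.2, dvd_swapRunners hi0 hi, swapRunners_div hi0 hi, swapRunners_mod hi0 hi]

theorem isAntisymm_swapRunners (hi0 : 0 < i) (hi : 2 * i < p ∧ p % 2 = 1) {x : ℕ → ℤ}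
    (hx : IsAntisymm p x) : IsAntisymm p fun r => x (swapRunners p i r) := by
  intro r hr0 hr
  simp only
  rw [swapRunners_sub hr0 hr hi, hx _ (swapRunners_pos hr0 hr hi0 hi) (swapRunners_lt hr hi0 hi)]

end Swap

/-! ### The involution `K_0` and the combined action on charges -/

/-- The action of `K_0` on charges. -/
def reflectZero (p : ℕ) (x : ℕ → ℤ) (r : ℕ) : ℤ :=
  if r = 1 then 1 - x 1 else if r = p - 1 then x 1 - 1 else x r

theorem isAntisymm_reflectZero {p : ℕ} (hp : 3 ≤ p) {x : ℕ → ℤ}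
    (hx : IsAntisymm p x) : IsAntisymm p (reflectZero p x) := by
  intro r hr0 hr
  have := hx r hr0 hr
  simp only [reflectZero]
  split_ifs <;> omega

theorem swapZero_of_mod_eq_one {p a : ℕ} (h : a % p = 1) : swapZero p a = a - 2 := by
  simp [swapZero, h]

theorem swapZero_of_mod_eq_sub_one {p a : ℕ} (hp : 3 ≤ p) (h : a % p = p - 1) :
    swapZero p a = a + 2 := by
  rw [swapZero, if_neg (by omega), if_pos h]

theorem swapZero_of_ne {p a : ℕ} (h : a % p ≠ 1) (h' : a % p ≠ p - 1) :
    swapZero p a = a := by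
  rw [swapZero, if_neg h, if_neg h']

theorem one_add_mul_succ {p : ℕ} (hp : 3 ≤ p) (k : ℕ) :
    1 + p * (k + 1) = (p - 1 + p * k) + 2 := by
  rw [mul_add]; omega

theorem swapZero_one_add_mul {p : ℕ} (hp : 3 ≤ p) (k : ℕ) :
    swapZero p (1 + p * (k + 1)) = p - 1 + p * k := by
  rw [swapZero_of_mod_eq_one (add_mul_mod (by omega) _), one_add_mul_succ hp]; omega

theorem swapZero_sub_one_add_mul {p : ℕ} (hp : 3 ≤ p) (k : ℕ) :
    swapZero p (p - 1 + p * k) = 1 + p * (k + 1) := by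
  rw [swapZero_of_mod_eq_sub_one hp (add_mul_mod (by omega) _), one_add_mul_succ hp]

theorem swapZero_add_mul {p r : ℕ} (hr : r < p) (h1 : r ≠ 1) (h2 : r ≠ p - 1) (k : ℕ) :
    swapZero p (r + p * k) = r + p * k := by
  rw [swapZero_of_ne] <;> rwa [add_mul_mod hr]

/-- The position `a`, given by its runner and its height. -/
theorem exists_eq_add_mul {p : ℕ} (hp : 0 < p) (a : ℕ) : ∃ r k, r < p ∧ a = r + p * k :=
  ⟨a % p, a / p, Nat.mod_lt a hp, (Nat.mod_add_div a p).symm⟩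

/-- The part 1 must be excluded, because truncated subtraction sends it to 0; `scopes` treats that
part separately. -/
theorem swapZero_swapZero {p : ℕ} (hp : 3 ≤ p) {a : ℕ} (ha : a ≠ 1) :
    swapZero p (swapZero p a) = a := by
  obtain ⟨r, k, hr, rfl⟩ := exists_eq_add_mul (show 0 < p by omega) a
  by_cases h1 : r = 1
  · subst h1
    obtain ⟨k, rfl⟩ : ∃ l, k = l + 1 := Nat.exists_eq_succ_of_ne_zero (by rintro rfl; simp at ha)
    rw [swapZero_one_add_mul hp, swapZero_sub_one_add_mul hp]
  · by_cases h2 : r = p - 1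
    · subst h2
      rw [swapZero_sub_one_add_mul hp, swapZero_one_add_mul hp]
    · rw [swapZero_add_mul hr h1 h2, swapZero_add_mul hr h1 h2]

theorem swapZero_ne_one {p : ℕ} (hp : 3 ≤ p) {a : ℕ} (ha : a ≠ 1) : swapZero p a ≠ 1 := by
  obtain ⟨r, k, hr, rfl⟩ := exists_eq_add_mul (show 0 < p by omega) a
  by_cases h1 : r = 1
  · subst h1
    obtain ⟨k, rfl⟩ : ∃ l, k = l + 1 := Nat.exists_eq_succ_of_ne_zero (by rintro rfl; simp at ha)
    rw [swapZero_one_add_mul hp]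
    omega
  · by_cases h2 : r = p - 1
    · subst h2
      rw [swapZero_sub_one_add_mul hp, mul_add]
      omega
    · rwa [swapZero_add_mul hr h1 h2]

theorem nodup_map_swapZero {p : ℕ} (hp : 3 ≤ p) {m : Multiset ℕ} (hm : m.Nodup) (h1 : 1 ∉ m) :
    (m.map (swapZero p)).Nodup := by
  refine hm.map_on fun a ha b hb hab => ?_
  have ha1 : a ≠ 1 := fun h => h1 (h ▸ ha)
  have hb1 : b ≠ 1 := fun h => h1 (h ▸ hb)
  rw [← swapZero_swapZero hp ha1, hab, swapZero_swapZero hp hb1]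

theorem mem_map_swapZero {p : ℕ} (hp : 3 ≤ p) {m : Multiset ℕ} (h1 : 1 ∉ m) {a : ℕ} :
    a ∈ m.map (swapZero p) ↔ a ≠ 1 ∧ swapZero p a ∈ m := by
  rw [Multiset.mem_map]
  constructor
  · rintro ⟨b, hb, rfl⟩
    have hb1 : b ≠ 1 := fun h => h1 (h ▸ hb)
    exact ⟨swapZero_ne_one hp hb1, by rwa [swapZero_swapZero hp hb1]⟩
  · rintro ⟨ha, h⟩
    exact ⟨_, h, swapZero_swapZero hp ha⟩

theorem IsAbacus.scopes_zero {p : ℕ} (hp : 3 ≤ p) {x : ℕ → ℤ} {ρ : Multiset ℕ}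
    (h : IsAbacus p x ρ) (hx : IsAntisymm p x) :
    IsAbacus p (reflectZero p x) (scopes p 0 ρ) := by
  have hx1 := hx 1 one_pos (by omega)
  have hone : 1 ∈ ρ ↔ 0 < x 1 := by
    simpa using h.mem_add_mul (r := 1) one_pos (by omega) 0
  -- A bead at a after `K_0` comes from `swapZero p a`, except that position 1 is toggled. Passing
  -- from runner p - 1 to runner 1 raises the level by one, which is the source of the 1 in 1 - x 1.
  have key : ∀ r k : ℕ, 0 < r → r < p → ((k : ℤ) < reflectZero p x r ↔ (r + p * k = 1 ∧ 1 ∉ ρ) ∨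
      (r + p * k ≠ 1 ∧ swapZero p (r + p * k) ∈ ρ)) := by
    intro r k hr0 hr
    by_cases h1 : r = 1
    · subst h1
      simp only [reflectZero, if_true]
      rcases k with _ | k
      · simp [hone]
        omega
      · have : 1 + p * (k + 1) ≠ 1 := by
          have : 0 < p * (k + 1) := by positivity
          omega
        rw [swapZero_one_add_mul hp, h.mem_add_mul (by omega) (by omega)]
        simp only [this, false_and, ne_eq, not_false_eq_true, true_and, false_or]
        push_cast
        omega
    · have hne : r + p * k ≠ 1 := by omega
      by_cases h2 : r = p - 1
      · subst h2
        rw [swapZero_sub_one_add_mul hp, h.mem_add_mul (by omega) (by omega)]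
        simp only [reflectZero, h1, if_true, if_false, hne, false_and, ne_eq, not_false_eq_true,
          true_and, false_or]
        push_cast
        omega
      · rw [swapZero_add_mul hr h1 h2, h.mem_add_mul hr0 hr]
        simp [reflectZero, h1, h2, hne]
  have hmem : ∀ a, a ∈ scopes p 0 ρ ↔
      (a = 1 ∧ 1 ∉ ρ) ∨ (a ≠ 1 ∧ swapZero p a ∈ ρ) := by
    intro a
    rw [scopes, if_pos rfl]
    split_ifs with h1
    · rw [mem_map_swapZero hp (h.1.notMem_erase)]
      simp only [h1, not_true, and_false, false_or]
      refine and_congr_right fun ha => ?_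
      rw [Multiset.mem_erase_of_ne (swapZero_ne_one hp ha)]
    · rw [Multiset.mem_cons, mem_map_swapZero hp h1]
      simp [h1]
  refine ⟨?_, fun a => ?_⟩
  · rw [scopes, if_pos rfl]
    split_ifs with h1
    · exact nodup_map_swapZero hp (h.1.erase 1) h.1.notMem_erase
    · refine Multiset.nodup_cons.2 ⟨fun h' => ?_, nodup_map_swapZero hp h.1 h1⟩
      exact ((mem_map_swapZero hp h1).1 h').1 rfl
  · rw [hmem]
    by_cases hpa : p ∣ a
    · simp only [hpa, not_true, false_and, iff_false]
      have h0 : a % p = 0 := Nat.mod_eq_zero_of_dvd hpa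
      rintro (⟨rfl, -⟩ | ⟨-, h'⟩)
      · rw [Nat.mod_eq_of_lt (by omega)] at h0
        omega
      · rw [swapZero_of_ne (by omega) (by omega)] at h'
        exact ((h.2 a).1 h').1 hpa
    · have := key (a % p) (a / p) (mod_pos_of_not_dvd hpa) (Nat.mod_lt a (by omega))
      rw [Nat.mod_add_div] at this
      rw [this]
      simp [hpa]

/-- The action of `K_i` on charges. -/
def reflect (p i : ℕ) (x : ℕ → ℤ) : ℕ → ℤ :=
  if i = 0 then reflectZero p x else fun r => x (swapRunners p i r)

theorem IsAntisymm.reflect {p : ℕ} (hp : 3 ≤ p) (hpo : Odd p) {i : ℕ} (hi : i ≤ tNum p) {x : ℕ → ℤ}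
    (hx : IsAntisymm p x) : IsAntisymm p (reflect p i x) := by
  have := tNum_of_odd hpo
  rw [SpinBlock.reflect]
  split_ifs with h0
  · exact isAntisymm_reflectZero hp hx
  · exact isAntisymm_swapRunners (by omega) (by omega) hx

theorem IsAbacus.scopes {p : ℕ} (hp : 3 ≤ p) (hpo : Odd p) {i : ℕ} (hi : i ≤ tNum p)
    {x : ℕ → ℤ} {ρ : Multiset ℕ} (h : IsAbacus p x ρ) (hx : IsAntisymm p x) :
    IsAbacus p (reflect p i x) (scopes p i ρ) := by
  have := tNum_of_odd hpo
  rw [reflect]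
  split_ifs with h0
  · subst h0
    exact h.scopes_zero hp hx
  · rw [SpinBlock.scopes, if_neg h0]
    exact h.map_swapRunners (by omega) (by omega)

theorem IsBarCore.scopes {p : ℕ} (hp : 3 ≤ p) (hpo : Odd p) {i : ℕ} (hi : i ≤ tNum p)
    {ρ : Multiset ℕ} (h : IsBarCore p ρ) : IsBarCore p (scopes p i ρ) :=
  ((h.isAbacus hpo).scopes hp hpo hi (isAntisymm_charge p ρ)).isBarCore hpo.pos
    ((isAntisymm_charge p ρ).reflect hp hpo hi)

theorem IsBarCore.charge_scopes {p : ℕ} (hp : 3 ≤ p) (hpo : Odd p) {i : ℕ} (hi : i ≤ tNum p)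
    {ρ : Multiset ℕ} (h : IsBarCore p ρ) {r : ℕ} (hr0 : 0 < r) (hr : r < p) :
    charge p (SpinBlock.scopes p i ρ) r = reflect p i (charge p ρ) r :=
  ((h.isAbacus hpo).scopes hp hpo hi (isAntisymm_charge p ρ)).charge_eq
    ((isAntisymm_charge p ρ).reflect hp hpo hi) hr0 hr

/-! ### Comparison of ranks -/

theorem sum_runnerRank_congr {p : ℕ} {x y : ℕ → ℤ}
    (h : ∀ j, 0 < j → j ≤ tNum p → x j = y j) :
    ∑ j ∈ Finset.Icc 1 (tNum p), runnerRank p j (x j) =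
      ∑ j ∈ Finset.Icc 1 (tNum p), runnerRank p j (y j) :=
  Finset.sum_congr rfl fun j hj => by
    rw [Finset.mem_Icc] at hj
    rw [h j (by omega) hj.2]

theorem sum_sub_sum_of_eq_off_one {t i : ℕ} (hi : i ∈ Finset.Icc 1 t) {f g : ℕ → ℤ}
    (h : ∀ j, 0 < j → j ≤ t → j ≠ i → f j = g j) :
    ∑ j ∈ Finset.Icc 1 t, f j - ∑ j ∈ Finset.Icc 1 t, g j = f i - g i := by
  rw [← Finset.sum_sub_distrib]
  exact Finset.sum_eq_single_of_mem i hi fun j hj0 hj => by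
    rw [h j (Finset.mem_Icc.1 hj0).1 (Finset.mem_Icc.1 hj0).2 hj, sub_self]

theorem sum_sub_sum_of_eq_off_two {t i : ℕ} (hi : 0 < i) (hit : i < t) {f g : ℕ → ℤ}
    (h : ∀ j, 0 < j → j ≤ t → j ≠ i → j ≠ i + 1 → f j = g j) :
    ∑ j ∈ Finset.Icc 1 t, f j - ∑ j ∈ Finset.Icc 1 t, g j =
      (f i - g i) + (f (i + 1) - g (i + 1)) := by
  rw [← Finset.sum_sub_distrib]
  refine Finset.sum_eq_add_of_mem i (i + 1) ?_ ?_ (by omega) ?_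
  · simp; omega
  · simp; omega
  · rintro j hj ⟨h1, h2⟩
    rw [h j (Finset.mem_Icc.1 hj).1 (Finset.mem_Icc.1 hj).2 h1 h2, sub_self]

/-- The change of the charge when a node of residue `i` is added. -/
def bump (p i j : ℕ) : ℤ :=
  if i = tNum p then (if j = i then -2 else 0)
  else (if j = i + 1 then 1 else 0) - (if j = i then 1 else 0)

theorem tNum_pos {p : ℕ} (hp : 3 ≤ p) : 0 < tNum p := by
  simp only [tNum]; omega

/-- The conditional on the right is L_i(x), later called `edgeLoss`. A node raises twice the total
rank by 2, so the remaining 2 p L_i(x) must be paid for by a drop of the weight by L_i(x). -/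
theorem sum_bump {p : ℕ} (hp : 3 ≤ p) (hpo : Odd p) {i : ℕ} (hi : i ≤ tNum p) (x : ℕ → ℤ) :
    ∑ j ∈ Finset.Icc 1 (tNum p), runnerRank p j (x j + bump p i j) -
      ∑ j ∈ Finset.Icc 1 (tNum p), runnerRank p j (x j) =
    2 + 2 * p * (if i = 0 then x 1 else if i = tNum p then 2 * (1 - x i)
      else x (i + 1) - x i + 1) := by
  have hpt := tNum_of_odd hpo
  have ht := tNum_pos hp
  have hpz : (p : ℤ) = 2 * (tNum p : ℕ) + 1 := by exact_mod_cast hpt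
  split_ifs with h0 h1
  · subst h0
    rw [sum_sub_sum_of_eq_off_one (i := 1) (by simp; omega)
      (f := fun j => runnerRank p j (x j + bump p 0 j)) (g := fun j => runnerRank p j (x j))]
    · simp only [bump, runnerRank, if_neg ht.ne]
      simp
      ring
    · intro j hj0 _ hj
      simp [bump, ht.ne, hj, hj0.ne']
  · rw [sum_sub_sum_of_eq_off_one (i := i) (by simp; omega)
      (f := fun j => runnerRank p j (x j + bump p i j)) (g := fun j => runnerRank p j (x j))]
    · simp only [bump, runnerRank, if_pos h1, if_true]
      rw [h1, hpz]
      ring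
    · intro j _ _ hj
      simp [bump, h1, h1 ▸ hj]
  · rw [sum_sub_sum_of_eq_off_two (i := i) (by omega) (by omega)
      (f := fun j => runnerRank p j (x j + bump p i j)) (g := fun j => runnerRank p j (x j))]
    · simp only [bump, runnerRank, if_neg h1, if_true]
      simp
      ring
    · intro j _ _ hj hj'
      simp [bump, h1, hj, hj']

/-! ### Parts and columns of Young diagrams -/

theorem zero_notMem_parts (lam : YoungDiagram) : 0 ∉ parts lam := fun h =>
  (lam.pos_of_mem_rowLens 0 (by simpa [parts] using h)).ne rfl

/-- The parts equal to k + 1 are the rows that meet column k but not column k + 1. -/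
theorem count_parts (lam : YoungDiagram) (k : ℕ) :
    (parts lam).count (k + 1) = lam.colLen k - lam.colLen (k + 1) := by
  rw [parts, YoungDiagram.rowLens, ← Multiset.map_coe, Multiset.count_map]
  have : (List.range (lam.colLen 0) : Multiset ℕ) = (Finset.range (lam.colLen 0)).val := rfl
  rw [this, ← Finset.filter_val, Finset.card_val, ← Nat.card_Ico]
  congr 1
  ext r
  have h1 := lam.mem_iff_lt_colLen (i := r) (j := k)
  have h2 := lam.mem_iff_lt_colLen (i := r) (j := k + 1)
  have h3 := lam.mem_iff_lt_rowLen (i := r) (j := k)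
  have h4 := lam.mem_iff_lt_rowLen (i := r) (j := k + 1)
  have h5 := lam.colLen_anti 0 k (Nat.zero_le _)
  rw [h1] at h3
  rw [h2] at h4
  simp only [Finset.mem_filter, Finset.mem_range, Finset.mem_Ico]
  omega

theorem mem_parts {lam : YoungDiagram} {k : ℕ} :
    k + 1 ∈ parts lam ↔ lam.colLen (k + 1) < lam.colLen k := by
  rw [← Multiset.count_pos, count_parts]
  omega

theorem colLen_of_cells_eq_union {lam mu : YoungDiagram} {A : ℕ × ℕ} (hA : A ∉ mu)
    (h : lam.cells = mu.cells ∪ {A}) (j : ℕ) :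
    lam.colLen j = mu.colLen j + if A.2 = j then 1 else 0 := by
  rw [YoungDiagram.colLen_eq_card, YoungDiagram.colLen_eq_card, YoungDiagram.col,
    YoungDiagram.col, h, Finset.filter_union, Finset.card_union_of_disjoint,
    Finset.filter_singleton]
  · split_ifs <;> simp
  · rw [Finset.disjoint_left]
    intro B hB hB'
    simp only [Finset.mem_filter, Finset.mem_singleton] at hB hB'
    exact hA ((YoungDiagram.mem_cells _).1 (hB'.1 ▸ hB.1))

/-- A row of length `c`, as a multiset of parts. -/
def rowPart (c : ℕ) : Multiset ℕ := if c = 0 then 0 else {c}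

theorem count_succ_rowPart (c k : ℕ) : (rowPart c).count (k + 1) = if c = k + 1 then 1 else 0 := by
  rw [rowPart]
  split_ifs with h1 h2 h2
  · omega
  · simp
  · simp [h2]
  · rw [Multiset.count_singleton, if_neg (Ne.symm h2)]

/-- Adding a node in column c replaces a row of length c by one of length c + 1. Written additively
it needs no multiset subtraction, and `rowPart 0 = 0` covers the start of a new row. -/
theorem parts_add_rowPart {lam mu : YoungDiagram} {A : ℕ × ℕ} (hA : A ∉ mu)
    (h : lam.cells = mu.cells ∪ {A}) :
    parts lam + rowPart A.2 = (A.2 + 1) ::ₘ parts mu := by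
  have hc := colLen_of_cells_eq_union hA h
  ext a
  rcases a with _ | k
  · have h0 : 0 ∉ rowPart A.2 := by
      rw [rowPart]
      split_ifs with h0
      · simp
      · simpa using Ne.symm h0
    rw [Multiset.count_add, Multiset.count_eq_zero_of_notMem (zero_notMem_parts lam),
      Multiset.count_eq_zero_of_notMem h0, Multiset.count_eq_zero_of_notMem]
    simpa using zero_notMem_parts mu
  · rw [Multiset.count_add, Multiset.count_cons, count_parts, count_parts, count_succ_rowPart]
    have h1 := hc k
    have h2 := hc (k + 1)
    have h3 := lam.colLen_anti k (k + 1) (Nat.le_succ _)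
    have h4 := mu.colLen_anti k (k + 1) (Nat.le_succ _)
    split_ifs at * <;> omega

theorem fst_eq_of_cells_eq_union {lam mu : YoungDiagram} {A : ℕ × ℕ} (hA : A ∉ mu)
    (h : lam.cells = mu.cells ∪ {A}) : A.1 = mu.colLen A.2 ∧ A.1 + 1 = lam.colLen A.2 := by
  have hc := colLen_of_cells_eq_union hA h A.2
  have h1 : A.1 < lam.colLen A.2 := by
    rw [← YoungDiagram.mem_iff_lt_colLen, ← YoungDiagram.mem_cells, h]
    simp
  have h2 : ¬ A.1 < mu.colLen A.2 := by
    rwa [← YoungDiagram.mem_iff_lt_colLen]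
  rw [if_pos rfl] at hc
  omega

theorem cells_eq_union_of_cells_eq_sdiff {lam mu : YoungDiagram} {A : ℕ × ℕ} (hA : A ∈ lam)
    (h : mu.cells = lam.cells \ {A}) : A ∉ mu ∧ lam.cells = mu.cells ∪ {A} := by
  refine ⟨fun h' => ?_, ?_⟩
  · rw [← YoungDiagram.mem_cells, h] at h'
    simp at h'
  · rw [h, Finset.sdiff_union_of_subset]
    simpa using hA

theorem exists_insert_cell (lam : YoungDiagram) {c : ℕ} (hc : c = 0 ∨ c ∈ parts lam) :
    ∃ mu : YoungDiagram, mu.cells = lam.cells ∪ {(lam.colLen c, c)} := by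
  refine ⟨⟨lam.cells ∪ {(lam.colLen c, c)}, ?_⟩, rfl⟩
  rintro ⟨r, k⟩ ⟨r', k'⟩ ⟨h1, h2⟩ hB
  simp only at h1 h2
  simp only [Finset.coe_union, Finset.coe_singleton, Set.mem_union, Finset.mem_coe,
    YoungDiagram.mem_cells, Set.mem_singleton_iff] at hB ⊢
  rcases hB with hB | hB
  · exact Or.inl (lam.up_left_mem h1 h2 hB)
  · obtain ⟨rfl, rfl⟩ := Prod.mk.inj hB
    rcases Nat.lt_or_ge k' k with hk | hk
    · left
      rcases hc with rfl | hc
      · omega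
      · obtain ⟨d, rfl⟩ : ∃ d, k = d + 1 := ⟨k - 1, by omega⟩
        rw [mem_parts] at hc
        have := lam.colLen_anti k' d (by omega)
        rw [YoungDiagram.mem_iff_lt_colLen]
        omega
    · obtain rfl : k' = k := by omega
      rcases Nat.lt_or_ge r' (lam.colLen k') with hr | hr
      · exact Or.inl (YoungDiagram.mem_iff_lt_colLen.2 hr)
      · right
        congr 1
        omega

theorem exists_erase_cell (lam : YoungDiagram) {c : ℕ} (hc : c + 1 ∈ parts lam) :
    ∃ mu : YoungDiagram, mu.cells = lam.cells \ {(lam.colLen c - 1, c)} := by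
  refine ⟨⟨lam.cells \ {(lam.colLen c - 1, c)}, ?_⟩, rfl⟩
  rintro ⟨r, k⟩ ⟨r', k'⟩ ⟨h1, h2⟩ hB
  simp only at h1 h2
  simp only [Finset.coe_sdiff, Finset.coe_singleton, Set.mem_sdiff, Finset.mem_coe,
    YoungDiagram.mem_cells, Set.mem_singleton_iff] at hB ⊢
  refine ⟨lam.up_left_mem h1 h2 hB.1, fun h => hB.2 ?_⟩
  obtain ⟨rfl, rfl⟩ := Prod.mk.inj h
  rw [mem_parts] at hc
  have h3 := YoungDiagram.mem_iff_lt_colLen.1 hB.1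
  rcases h2.lt_or_eq with hk | rfl
  · have := lam.colLen_anti (k' + 1) k hk
    omega
  · congr 1
    omega

/-! ### Addable and removable nodes -/

/-- Neighbouring columns share a residue only across a period boundary, where both residues are 0.
So the two-node clauses for addable and removable nodes matter only for i = 0. -/
theorem res_succ_eq {p c : ℕ} (hp : Odd p) (h : res p c = res p (c + 1)) :
    c % p = p - 1 ∧ res p c = 0 := by
  have hpt := tNum_of_odd hp
  have h1 := Nat.mod_lt c hp.pos
  rcases Nat.lt_or_ge (c % p + 1) p with h2 | h2
  · have h3 : (c + 1) % p = c % p + 1 := by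
      rw [← Nat.mod_add_mod, Nat.mod_eq_of_lt h2]
    rw [res, res, h3] at h
    split_ifs at h <;> omega
  · have : c % p = p - 1 := by omega
    refine ⟨this, ?_⟩
    rw [res, this]
    split_ifs <;> omega

/-- These necessary conditions on the column serve to exclude unwanted signs from a signature;
`isAddable_of_mem` produces the signs that are needed. -/
theorem IsAddable.props {p i : ℕ} (hp3 : 3 ≤ p) (hp : Odd p) {lam : YoungDiagram} {B : ℕ × ℕ}
    (h : IsAddable p i lam B) :
    B.1 = lam.colLen B.2 ∧ res p B.2 = i ∧
      ((B.2 = 0 ∨ B.2 ∈ parts lam) ∧ (B.2 + 1 ∉ parts lam ∨ p ∣ B.2 + 1) ∨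
        ∃ c ∈ parts lam, B.2 = c + 1 ∧ c % p = p - 1 ∧ i = 0) := by
  have aux : ∀ {A : ℕ × ℕ} {mu : YoungDiagram}, A ∉ lam → mu.cells = lam.cells ∪ {A} →
      A.2 = 0 ∨ A.2 ∈ parts lam := by
    intro A mu hA hmu
    have h1 := parts_add_rowPart hA hmu
    by_cases h0 : A.2 = 0
    · exact Or.inl h0
    · right
      rw [rowPart, if_neg h0] at h1
      have : A.2 ∈ (A.2 + 1) ::ₘ parts lam := h1 ▸ by simp
      rcases Multiset.mem_cons.1 this with h' | h'
      · omega
      · exact h'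
  obtain ⟨hB, ⟨hres, mu, hmu, hs⟩ | ⟨c, hc, hA, hres, hres', ⟨nu, hnu, -⟩, mu, hmu, -⟩⟩ := h
  · refine ⟨(fst_eq_of_cells_eq_union hB hmu).1, hres, Or.inl ⟨aux hB hmu, ?_⟩⟩
    have h1 := parts_add_rowPart hB hmu
    by_contra! hcon
    have h2 := congrArg (Multiset.count (B.2 + 1)) h1
    have h3 := Multiset.count_pos.2 hcon.1
    rw [Multiset.count_cons_self, Multiset.count_add, count_succ_rowPart, if_neg (by omega)] at h2
    have h4 := hs.2 (B.2 + 1) (Multiset.count_pos.1 (by omega)) hcon.2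
    omega
  · have hr := res_succ_eq hp (c := c) (by rw [hres, ← hc, hres'])
    have h1 := (fst_eq_of_cells_eq_union hA hnu)
    have hmu' : mu.cells = nu.cells ∪ {B} := by
      rw [hmu, hnu, Finset.union_assoc]
      rfl
    have hBnu : B ∉ nu := by
      rw [← YoungDiagram.mem_cells, hnu]
      simp only [Finset.mem_union, YoungDiagram.mem_cells, Finset.mem_singleton, not_or]
      refine ⟨hB, fun h => ?_⟩
      have := congrArg Prod.snd h
      simp only at this
      omega
    have h2 := fst_eq_of_cells_eq_union hBnu hmu'
    have h3 := colLen_of_cells_eq_union hA hnu B.2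
    rw [if_neg (by simp only; omega)] at h3
    refine ⟨by omega, hres', Or.inr ⟨c, ?_, hc, hr.1, by rw [← hres, hr.2]⟩⟩
    refine (aux hA hnu).resolve_left fun h0 => ?_
    simp only at h0
    rw [h0, Nat.zero_mod] at hr
    omega

theorem IsRemovable.props {p i : ℕ} (hp : Odd p) {lam : YoungDiagram} {A : ℕ × ℕ}
    (h : IsRemovable p i lam A) :
    A.1 + 1 = lam.colLen A.2 ∧ res p A.2 = i ∧
      (A.2 + 1 ∈ parts lam ∧ (A.2 ∉ parts lam ∨ p ∣ A.2) ∨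
        A.2 + 2 ∈ parts lam ∧ A.2 % p = p - 1 ∧ i = 0) := by
  have aux : ∀ {A : ℕ × ℕ} {mu : YoungDiagram}, A ∈ lam → mu.cells = lam.cells \ {A} →
      A.2 + 1 ∈ parts lam := by
    intro A mu hA hmu
    obtain ⟨hA', hlam⟩ := cells_eq_union_of_cells_eq_sdiff hA hmu
    have h1 := parts_add_rowPart hA' hlam
    have h2 := congrArg (Multiset.count (A.2 + 1)) h1
    rw [Multiset.count_cons_self, Multiset.count_add, count_succ_rowPart, if_neg (by omega)] at h2
    exact Multiset.count_pos.1 (by omega)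
  obtain ⟨hA, ⟨hres, mu, hmu, hs⟩ | ⟨hB, hres, hres', ⟨nu, hnu, -⟩, mu, hmu, -⟩⟩ := h
  · obtain ⟨hA', hlam⟩ := cells_eq_union_of_cells_eq_sdiff hA hmu
    refine ⟨(fst_eq_of_cells_eq_union hA' hlam).2, hres, Or.inl ⟨aux hA hmu, ?_⟩⟩
    have h1 := parts_add_rowPart hA' hlam
    by_contra! hcon
    obtain ⟨k, hk⟩ : ∃ k, A.2 = k + 1 :=
      Nat.exists_eq_succ_of_ne_zero fun h0 => zero_notMem_parts lam (h0 ▸ hcon.1)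
    have h2 := congrArg (Multiset.count A.2) h1
    have h3 := Multiset.count_pos.2 hcon.1
    rw [Multiset.count_cons_of_ne (by omega), Multiset.count_add] at h2
    have h5 : (rowPart A.2).count A.2 = 1 := by rw [hk, count_succ_rowPart, if_pos rfl]
    have h4 := hs.2 A.2 (Multiset.count_pos.1 (by omega)) hcon.2
    omega
  · have hr := res_succ_eq hp (hres.trans hres'.symm)
    obtain ⟨hB', hlam⟩ := cells_eq_union_of_cells_eq_sdiff hB hnu
    have hmu' : mu.cells = nu.cells \ {A} := by
      rw [hmu, hnu, sdiff_sdiff_left]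
      congr 1
      exact Finset.pair_comm _ _
    have hAnu : A ∈ nu := by
      rw [← YoungDiagram.mem_cells, hnu]
      simp only [Finset.mem_sdiff, YoungDiagram.mem_cells, Finset.mem_singleton]
      refine ⟨hA, fun h => ?_⟩
      have := congrArg Prod.snd h
      simp only at this
      omega
    obtain ⟨hA', hnu'⟩ := cells_eq_union_of_cells_eq_sdiff hAnu hmu'
    have h2 := fst_eq_of_cells_eq_union hA' hnu'
    have h3 := colLen_of_cells_eq_union hB' hlam A.2
    rw [if_neg (by simp only; omega)] at h3
    exact ⟨by omega, hres, Or.inr ⟨aux hB hnu, hr.1, by rw [← hres, hr.2]⟩⟩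

theorem isAddable_of_mem {p i c : ℕ} {lam : YoungDiagram} (hlam : IsPStrict p (parts lam))
    (hc : c ∈ parts lam) (hc' : c + 1 ∉ parts lam ∨ p ∣ c + 1) (hres : res p c = i) :
    IsAddable p i lam (lam.colLen c, c) := by
  have hB : (lam.colLen c, c) ∉ lam := by simp [YoungDiagram.mem_iff_lt_colLen]
  obtain ⟨mu, hmu⟩ := exists_insert_cell lam (Or.inr hc)
  refine ⟨hB, Or.inl ⟨hres, mu, hmu, ?_⟩⟩
  have h1 := parts_add_rowPart hB hmu
  have hc0 : c ≠ 0 := fun h0 => hlam.1 (h0 ▸ hc)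
  obtain ⟨n, hn⟩ := Multiset.exists_cons_of_mem hc
  simp only [rowPart, if_neg hc0] at h1
  rw [hn, Multiset.cons_swap, ← Multiset.singleton_add c, add_comm, Multiset.add_right_inj] at h1
  rw [h1]
  rw [hn] at hlam hc'
  refine isPStrict_cons (isPStrict_of_cons hlam) (Nat.succ_pos c) ?_
  exact hc'.imp_left fun h h' => h (Multiset.mem_cons_of_mem h')

theorem isRemovable_of_mem {p i c : ℕ} {lam : YoungDiagram} (hlam : IsPStrict p (parts lam))
    (hc : c + 1 ∈ parts lam) (hc' : c ∉ parts lam ∨ p ∣ c) (hres : res p c = i) :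
    IsRemovable p i lam (lam.colLen c - 1, c) := by
  have hlt := mem_parts.1 hc
  have hA : (lam.colLen c - 1, c) ∈ lam := by
    rw [YoungDiagram.mem_iff_lt_colLen]
    omega
  obtain ⟨mu, hmu⟩ := exists_erase_cell lam hc
  refine ⟨hA, Or.inl ⟨hres, mu, hmu, ?_⟩⟩
  obtain ⟨hA', hlam'⟩ := cells_eq_union_of_cells_eq_sdiff hA hmu
  have h1 := parts_add_rowPart hA' hlam'
  obtain ⟨n, hn⟩ := Multiset.exists_cons_of_mem hc
  rw [hn] at hlam hc'
  rw [hn, Multiset.cons_add, Multiset.cons_inj_right] at h1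
  rw [← h1]
  simp only [rowPart]
  split_ifs with h0
  · simpa using isPStrict_of_cons hlam
  · rw [add_comm, Multiset.singleton_add]
    exact isPStrict_cons (isPStrict_of_cons hlam) (Nat.pos_of_ne_zero h0)
      (hc'.imp_left fun h h' => h (Multiset.mem_cons_of_mem h'))

/-! ### The effect of a node on charges -/

theorem charge_rowPart {p j : ℕ} (hj : 0 < j) (hjp : j < p) (c : ℕ) :
    charge p (rowPart c) j = beadSign p j c := by
  rw [rowPart]
  split_ifs with h
  · rw [h, charge_zero, beadSign_eq_zero hj hjp (dvd_zero p)]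
  · simp [charge]

/-- Columns r and p - 1 - r share a residue because the bead moves r → r + 1 and p - 1 - r → p - r,
on opposite runners in reverse directions, have the same effect on the charge. -/
theorem beadSign_succ_sub {p : ℕ} (hp3 : 3 ≤ p) (hp : Odd p) {j : ℕ} (hj : 0 < j)
    (hjt : j ≤ tNum p) (c : ℕ) :
    beadSign p j (c + 1) - beadSign p j c = bump p (res p c) j := by
  have hpt := tNum_of_odd hp
  have h1 := Nat.mod_lt c hp.pos
  have h2 : (c % p + 1 = p ∧ (c + 1) % p = 0) ∨ (c % p + 1 < p ∧ (c + 1) % p = c % p + 1) := by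
    rcases (show c % p + 1 ≤ p from h1).eq_or_lt with h | h
    · exact Or.inl ⟨h, by rw [← Nat.mod_add_mod, h, Nat.mod_self]⟩
    · exact Or.inr ⟨h, by rw [← Nat.mod_add_mod, Nat.mod_eq_of_lt h]⟩
  have h3 : (c % p ≤ tNum p ∧ res p c = c % p) ∨ (tNum p < c % p ∧ res p c = p - 1 - c % p) := by
    rw [res]
    split_ifs <;> omega
  simp only [beadSign, bump]
  generalize res p c = e at *
  generalize c % p = r at *
  generalize (c + 1) % p = r' at *
  split_ifs <;> omega

theorem charge_of_cells_eq_union {p : ℕ} (hp3 : 3 ≤ p) (hp : Odd p) {lam mu : YoungDiagram}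
    {A : ℕ × ℕ} (hA : A ∉ mu) (h : lam.cells = mu.cells ∪ {A}) {j : ℕ} (hj : 0 < j)
    (hjt : j ≤ tNum p) :
    charge p (parts lam) j = charge p (parts mu) j + bump p (res p A.2) j := by
  have hpt := tNum_of_odd hp
  have h1 := congrArg (charge p · j) (parts_add_rowPart hA h)
  simp only [charge_add, charge_cons, charge_rowPart hj (show j < p by omega)] at h1
  have := beadSign_succ_sub hp3 hp hj hjt A.2
  linarith

theorem sum_of_cells_eq_union {lam mu : YoungDiagram}
    {A : ℕ × ℕ} (hA : A ∉ mu) (h : lam.cells = mu.cells ∪ {A}) :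
    (parts lam).sum = (parts mu).sum + 1 := by
  have h1 := congrArg Multiset.sum (parts_add_rowPart hA h)
  have h2 : (rowPart A.2).sum = A.2 := by
    rw [rowPart]
    split_ifs with h <;> simp [h]
  rw [Multiset.sum_add, Multiset.sum_cons, h2] at h1
  omega

/-! ### Edges of the crystal graph and the weights of the blocks they join -/

theorem mem_of_reflTransGen_erasePair {S R : List SignedNode}
    (h : Relation.ReflTransGen ErasePair S R) {x : SignedNode} (hx : x ∈ R) : x ∈ S := by
  induction h with
  | refl => exact hx
  | tail _ h ih =>
    obtain ⟨u, v, A, B, rfl, rfl⟩ := h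
    apply ih
    simp only [List.mem_append, List.mem_cons] at hx ⊢
    tauto

theorem IsCogood.isAddable {p i : ℕ} {lam : YoungDiagram} {B : ℕ × ℕ} (h : IsCogood p i lam B) :
    IsAddable p i lam B := by
  obtain ⟨u, v, ⟨S, hS, hR, -⟩, -⟩ := h
  exact (hS.2.1 B).1 (mem_of_reflTransGen_erasePair hR (by simp))

theorem IsGood.isRemovable {p i : ℕ} {lam : YoungDiagram} {A : ℕ × ℕ} (h : IsGood p i lam A) :
    IsRemovable p i lam A := by
  obtain ⟨u, v, ⟨S, hS, hR, -⟩, -⟩ := h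
  exact (hS.2.2 A).1 (mem_of_reflTransGen_erasePair hR (by simp))

theorem CrystalEdge.exists_cell {p i : ℕ} (hp3 : 3 ≤ p) (hp : Odd p) {lam mu : YoungDiagram}
    (h : CrystalEdge p i lam mu) : ∃ A, A ∉ lam ∧ mu.cells = lam.cells ∪ {A} ∧ res p A.2 = i := by
  obtain ⟨-, -, ⟨B, hB, hmu⟩ | ⟨A, hA, hlam⟩⟩ := h
  · exact ⟨B, hB.isAddable.1, hmu, (hB.isAddable.props hp3 hp).2.1⟩
  · have hA' := hA.isRemovable
    obtain ⟨h1, h2⟩ := cells_eq_union_of_cells_eq_sdiff hA'.1 hlam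
    exact ⟨A, h1, h2, (hA'.props hp).2.1⟩

theorem BlockEdge.charge_eq {p i : ℕ} (hp3 : 3 ≤ p) (hp : Odd p) {ρ σ : Multiset ℕ} {w v : ℕ}
    (h : BlockEdge p i ρ w σ v) {j : ℕ} (hj : 0 < j) (hjt : j ≤ tNum p) :
    charge p σ j = charge p ρ j + bump p i j := by
  have hpt := tNum_of_odd hp
  obtain ⟨lam, mu, hlam, hmu, he⟩ := h
  obtain ⟨A, hA, hA', rfl⟩ := he.exists_cell hp3 hp
  rw [← hlam.2.2.charge_eq hj (by omega), ← hmu.2.2.charge_eq hj (by omega)]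
  exact charge_of_cells_eq_union hp3 hp hA hA' hj hjt

theorem BlockEdge.sum_eq {p i : ℕ} (hp3 : 3 ≤ p) (hp : Odd p) {ρ σ : Multiset ℕ} {w v : ℕ}
    (h : BlockEdge p i ρ w σ v) : σ.sum + p * v = ρ.sum + p * w + 1 := by
  obtain ⟨lam, mu, hlam, hmu, he⟩ := h
  obtain ⟨A, hA, hA', -⟩ := he.exists_cell hp3 hp
  rw [← hlam.2.2.sum_eq, ← hmu.2.2.sum_eq]
  exact sum_of_cells_eq_union hA hA'

/-- The amount by which the weight drops when a node of residue `i` is added to a partition in a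
block with charge `x`. -/
def edgeLoss (p i : ℕ) (x : ℕ → ℤ) : ℤ :=
  if i = 0 then x 1 else if i = tNum p then 2 * (1 - x i) else x (i + 1) - x i + 1

/-- The sizes of the two cores and the total ranks are both known, which gives v = w - L_i(x); and v
≥ 0. -/
theorem BlockEdge.edgeLoss_le {p i : ℕ} (hp3 : 3 ≤ p) (hp : Odd p) (hi : i ≤ tNum p)
    {ρ σ : Multiset ℕ} {w v : ℕ} (h : BlockEdge p i ρ w σ v) :
    edgeLoss p i (charge p ρ) ≤ w := by
  have hρ : IsBarCore p ρ := by obtain ⟨lam, mu, hlam, hmu, he⟩ := h; exact hlam.1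
  have hσ : IsBarCore p σ := by obtain ⟨lam, mu, hlam, hmu, he⟩ := h; exact hmu.1
  have h1 := hρ.two_mul_sum hp
  have h2 := hσ.two_mul_sum hp
  have h3 := h.sum_eq hp3 hp
  rw [sum_runnerRank_congr fun j hj hjt => h.charge_eq hp3 hp hj hjt] at h2
  have h4 := sum_bump hp3 hp hi (charge p ρ)
  rw [← h1, ← h2] at h4
  change _ = 2 + 2 * p * edgeLoss p i (charge p ρ) at h4
  have h5 : (σ.sum : ℤ) + p * v = ρ.sum + p * w + 1 := by exact_mod_cast h3
  have h6 : (p : ℤ) * (edgeLoss p i (charge p ρ)) ≤ p * w := by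
    have : (0 : ℤ) ≤ p * v := by positivity
    linarith
  exact le_of_mul_le_mul_left h6 (by exact_mod_cast hp.pos)

theorem isExternal_of_lt_edgeLoss {p i : ℕ} (hp3 : 3 ≤ p) (hp : Odd p) (hi : i ≤ tNum p)
    {ρ : Multiset ℕ} {w : ℕ} (h : (w : ℤ) < edgeLoss p i (charge p ρ)) : IsExternal p i ρ w :=
  Or.inl fun _ _ he => absurd (he.edgeLoss_le hp3 hp hi) (not_le.2 h)

/-! ### Locally irreducible blocks -/

theorem swapRunners_eq_succ {p i : ℕ} (hi : 2 * i < p ∧ p % 2 = 1) : swapRunners p i i = i + 1 := by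
  have := swapRunners_cases (p := p) (i := i) (r := i) (by omega) hi
  omega

theorem swapRunners_succ {p i : ℕ} (hi : 2 * i < p ∧ p % 2 = 1) (h : 2 * (i + 1) < p) :
    swapRunners p i (i + 1) = i := by
  have := swapRunners_cases (p := p) (i := i) (r := i + 1) (by omega) hi
  omega

theorem swapRunners_of_ne {p i j : ℕ} (hi : 2 * i < p ∧ p % 2 = 1) (hj : 2 * j < p) (h : j ≠ i)
    (h' : j ≠ i + 1) : swapRunners p i j = j := by
  have := swapRunners_cases (p := p) (i := i) (r := j) (by omega) hi
  omega

/-- The change of twice the rank of a core under `K_i`. -/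
theorem IsBarCore.two_mul_sum_scopes {p : ℕ} (hp3 : 3 ≤ p) (hp : Odd p) {i : ℕ} (hi : i ≤ tNum p)
    {ρ : Multiset ℕ} (h : IsBarCore p ρ) :
    2 * ((SpinBlock.scopes p i ρ).sum : ℤ) - 2 * ρ.sum =
      if i = 0 then 2 - 4 * charge p ρ 1 else if i = tNum p then 2 * charge p ρ i
      else -2 * (charge p ρ (i + 1) - charge p ρ i) := by
  have hpt := tNum_of_odd hp
  have ht := tNum_pos hp3
  have hpz : (p : ℤ) = 2 * (tNum p : ℕ) + 1 := by exact_mod_cast hpt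
  rw [(h.scopes hp3 hp hi).two_mul_sum hp, h.two_mul_sum hp,
    sum_runnerRank_congr fun j hj hjt => h.charge_scopes hp3 hp hi hj (by omega)]
  set x := charge p ρ
  have hx : IsAntisymm p x := isAntisymm_charge p ρ
  split_ifs with h0 h1
  · subst h0
    rw [sum_sub_sum_of_eq_off_one (i := 1) (by simp; omega)
      (f := fun j => runnerRank p j (reflect p 0 x j)) (g := fun j => runnerRank p j (x j))]
    · simp only [runnerRank, reflect, reflectZero, if_true]
      push_cast
      ring
    · intro j hj0 hjt hj
      simp only [reflect, reflectZero, if_true, if_neg hj]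
      rw [if_neg (by omega)]
  · rw [sum_sub_sum_of_eq_off_one (i := i) (by simp; omega)
      (f := fun j => runnerRank p j (reflect p i x j)) (g := fun j => runnerRank p j (x j))]
    · simp only [runnerRank, reflect, if_neg h0]
      rw [swapRunners_eq_succ (by omega), show i + 1 = p - i by omega, hx i (by omega) (by omega),
        hpz, ← h1]
      ring
    · intro j hj0 hjt hj
      simp only [reflect, if_neg h0]
      rw [swapRunners_of_ne (by omega) (by omega) hj (by omega)]
  · rw [sum_sub_sum_of_eq_off_two (i := i) (by omega) (by omega)
      (f := fun j => runnerRank p j (reflect p i x j)) (g := fun j => runnerRank p j (x j))]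
    · simp only [runnerRank, reflect, if_neg h0]
      rw [swapRunners_eq_succ (by omega), swapRunners_succ (by omega) (by omega)]
      push_cast
      ring
    · intro j hj0 hjt hj hj'
      simp only [reflect, if_neg h0]
      rw [swapRunners_of_ne (by omega) (by omega) hj hj']

/-- The inequalities satisfied by the charge of a locally irreducible block of weight `w`. -/
structure IsTame (t w : ℕ) (x : ℕ → ℤ) : Prop where
  one_le : x 1 ≤ w
  step_le : ∀ i, 0 < i → i < t → x (i + 1) - x i ≤ w - 1 ∨ x (i + 1) ≤ x i
  last_ge : 0 ≤ x t ∨ 2 * (1 - x t) ≤ w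

/-- Violating one of the inequalities means two things at once: the loss L_i(x) exceeds w, so K_i is
allowed, and K_i lowers the rank. -/
theorem NoReducingAction.isTame {p w : ℕ} (hp3 : 3 ≤ p) (hp : Odd p) {ρ : Multiset ℕ}
    (hρ : IsBarCore p ρ) (h : NoReducingAction p w ρ) : IsTame (tNum p) w (charge p ρ) := by
  have ht := tNum_pos hp3
  have key : ∀ i ≤ tNum p, (w : ℤ) < edgeLoss p i (charge p ρ) →
      0 ≤ 2 * ((SpinBlock.scopes p i ρ).sum : ℤ) - 2 * ρ.sum := by
    intro i hi hw
    have h1 := h _ ⟨i, hi, isExternal_of_lt_edgeLoss hp3 hp hi hw, rfl⟩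
    rw [blockRank, blockRank] at h1
    omega
  refine ⟨?_, fun i hi0 hi => ?_, ?_⟩
  · by_contra! hc
    have h1 := key 0 (Nat.zero_le _) (by simpa [edgeLoss] using hc)
    rw [hρ.two_mul_sum_scopes hp3 hp (Nat.zero_le _), if_pos rfl] at h1
    omega
  · by_contra! hc
    have h1 := key i hi.le (by
      rw [edgeLoss, if_neg (by omega), if_neg (by omega)]
      omega)
    rw [hρ.two_mul_sum_scopes hp3 hp hi.le, if_neg (by omega), if_neg (by omega)] at h1
    omega
  · by_contra! hc
    have h1 := key (tNum p) le_rfl (by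
      rw [edgeLoss, if_neg (by omega), if_pos rfl]
      omega)
    rw [hρ.two_mul_sum_scopes hp3 hp le_rfl, if_neg (by omega), if_pos rfl] at h1
    omega

/-- The absolute values of a tame charge have no large gaps. -/
theorem IsTame.natAbs_le {t w : ℕ} {x : ℕ → ℤ} (h : IsTame t w x) {a b : ℕ} (hb : w < b)
    (hab : a + w ≤ b) (hgap : ∀ j, 0 < j → j ≤ t → (x j).natAbs ≤ a ∨ b ≤ (x j).natAbs) {j : ℕ}
    (hj : 0 < j) (hjt : j ≤ t) : (x j).natAbs ≤ a := by
  have h1 := h.one_le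
  have h3 := h.last_ge
  -- From left to right: x 1 ≤ w < b, and an ascent of at most w - 1 from a value ≤ a stays below b,
  -- hence is ≤ a by the gap hypothesis.
  have up : ∀ j, 0 < j → j ≤ t → x j ≤ a := by
    intro j hj
    induction j, hj using Nat.le_induction with
    | base =>
      intro hjt
      have := hgap 1 one_pos hjt
      change x 1 ≤ a
      omega
    | succ j hj ih =>
      intro hjt
      have h4 := ih (by omega)
      have h5 := hgap (j + 1) (by omega) hjt
      have h6 := h.step_le j hj hjt
      omega
  -- From right to left: x t is above -b by the last inequality, and going back one step lowers the
  -- value by at most w - 1, which again cannot cross from -a to -b.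
  have down : ∀ k, k < t → -(a : ℤ) ≤ x (t - k) := by
    intro k
    induction k with
    | zero =>
      intro hk
      have h4 := hgap t (by omega) le_rfl
      rw [Nat.sub_zero]
      omega
    | succ k ih =>
      intro hk
      have h4 := ih (by omega)
      have h5 := hgap (t - (k + 1)) (by omega) (by omega)
      have h6 := h.step_le (t - (k + 1)) (by omega) (by omega)
      have h7 := up (t - k) (by omega) (by omega)
      rw [show t - (k + 1) + 1 = t - k by omega] at h6
      omega
  have h4 := up j hj hjt
  have h5 := down (t - j) (by omega)
  rw [show t - (t - j) = j by omega] at h5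
  omega

theorem IsTame.eq_zero {t : ℕ} {x : ℕ → ℤ} (h : IsTame t 0 x) {j : ℕ}
    (hj : 0 < j) (hjt : j ≤ t) : x j = 0 := by
  have := h.natAbs_le (a := 0) (b := 1) (by omega) (by omega) (fun j _ _ => by omega) hj hjt
  omega

/-! ### Maximality of the rank of the extremal block -/

/-- The charge of the extremal block. -/
def maxCharge (w i : ℕ) : ℤ := w + (w - 1) * ((i : ℤ) - 1)

theorem runnerRank_le_of_le {p j : ℕ} {z z' : ℤ} (h0 : 0 ≤ z) (h : z ≤ z') :
    runnerRank p j z ≤ runnerRank p j z' := by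
  rw [runnerRank, runnerRank]
  rcases h0.eq_or_lt with rfl | h0
  · have : 0 ≤ z' * (z' - 1) := by
      rcases h.eq_or_lt with rfl | h
      · simp
      · exact mul_nonneg h.le (by omega)
    have : 0 ≤ 2 * (j : ℤ) * z' := by positivity
    nlinarith
  · have : z * (z - 1) ≤ z' * (z' - 1) := by nlinarith
    gcongr

theorem runnerRank_lt_of_lt {p j : ℕ} (hj : 0 < j) {z z' : ℤ} (h0 : 0 ≤ z) (h : z < z') :
    runnerRank p j z < runnerRank p j z' := by
  -- With j = 0 this is monotonicity of the quadratic part alone; the linear part 2 j z is then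
  -- strictly increasing.
  have h1 := runnerRank_le_of_le (p := p) (j := 0) h0 h.le
  rw [runnerRank, runnerRank] at *
  have : (0 : ℤ) < j := by exact_mod_cast hj
  push_cast at h1
  nlinarith

/-- An upper bound for `runnerRank`, independent of the runner. -/
def runnerBound (p n : ℕ) : ℤ := 2 * ((p : ℤ) - 1) * n + p * (n * ((n : ℤ) - 1))

theorem runnerRank_le_runnerBound {p j : ℕ} (hj : 0 < j) (hjp : j < p) (z : ℤ) :
    runnerRank p j z ≤ runnerBound p z.natAbs := by
  have hj1 : (1 : ℤ) ≤ j := by exact_mod_cast hj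
  have hj2 : (j : ℤ) ≤ p - 1 := by omega
  rw [runnerRank, runnerBound]
  rcases le_total 0 z with h | h
  · rw [show (z.natAbs : ℤ) = z by omega]
    nlinarith
  · rw [show (z.natAbs : ℤ) = -z by omega]
    nlinarith

/-- The bound for n equals p n (n + 1) - 2 n, while n + 1 beads on any runner already give 2 i (n +
1) + p n (n + 1). One more bead therefore outweighs every choice of runner. -/
theorem runnerBound_lt {p i n n' : ℕ} (hp : 0 < p) (hi : 0 < i) (hn : n < n') :
    runnerBound p n < runnerRank p i n' := by
  have hp1 : (1 : ℤ) ≤ p := by exact_mod_cast hp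
  have h1 : runnerBound p n < runnerRank p i ((n + 1 : ℕ) : ℤ) := by
    rw [runnerBound, runnerRank]
    push_cast
    have : (1 : ℤ) ≤ i := by exact_mod_cast hi
    have : (0 : ℤ) ≤ n := by positivity
    nlinarith
  exact h1.trans_le (runnerRank_le_of_le (by positivity) (by exact_mod_cast hn))

/-- Sorting the absolute values loses track of the runners, but every sorted value is strictly below
the corresponding extremal charge, so the runner-independent bound suffices. -/
theorem IsTame.sum_runnerRank_lt_of_small {p t w : ℕ} (htp : t < p) (hw : 2 ≤ w) {x : ℕ → ℤ}
    (h : IsTame t w x) {i : ℕ} (hi : 0 < i) (hit : i ≤ t) (hx : (x i).natAbs < w) :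
    ∑ j ∈ Finset.Icc 1 t, runnerRank p j (x j) <
      ∑ j ∈ Finset.Icc 1 t, runnerRank p j (maxCharge w j) := by
  have conv : ∀ f : ℕ → ℤ, ∑ j ∈ Finset.Icc 1 t, f j = ∑ k : Fin t, f (k + 1) := by
    intro f
    rw [Fin.sum_univ_eq_sum_range (fun k => f (k + 1)), Finset.range_eq_Ico,
      Finset.sum_Ico_add' f 0 t 1]
    rfl
  rw [conv, conv]
  set y : Fin t → ℕ := fun k => (x (k + 1)).natAbs with hy
  set e := Tuple.sort y
  have hmono : Monotone (y ∘ e) := Tuple.monotone_sort y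
  -- The smallest value is at most |x i| ≤ w - 1, and later values grow by at most w - 1, except for
  -- a possible jump up to w. That jump is harmless since w ≤ 2 (w - 1).
  have hle : ∀ (k : ℕ) (hk : k < t), y (e ⟨k, hk⟩) ≤ (k + 1) * (w - 1) := by
    intro k
    induction k with
    | zero =>
      intro hk
      have h1 := hmono (show ⟨0, hk⟩ ≤ e.symm ⟨i - 1, by omega⟩ from Nat.zero_le _)
      simp only [Function.comp_apply, Equiv.apply_symm_apply] at h1
      have h2 : y ⟨i - 1, by omega⟩ = (x i).natAbs := by
        simp only [hy]
        rw [show i - 1 + 1 = i by omega]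
      omega
    | succ k ih =>
      intro hk
      have h1 := ih (by omega)
      -- Otherwise there is a gap between the k-th and (k+1)-st sorted values, and the gap lemma
      -- would force all values to lie below it.
      have h2 : y (e ⟨k + 1, hk⟩) < max (y (e ⟨k, by omega⟩) + w) (w + 1) := by
        by_contra! hc
        have h3 := h.natAbs_le (a := y (e ⟨k, by omega⟩)) (b := y (e ⟨k + 1, hk⟩)) (by omega)
          (by omega) (fun j hj hjt => ?_) (j := e ⟨k + 1, hk⟩ + 1) (by omega) (by omega)
        · change y (e ⟨k + 1, hk⟩) ≤ _ at h3
          omega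
        · have h4 : (x j).natAbs = (y ∘ e) (e.symm ⟨j - 1, by omega⟩) := by
            simp only [hy, Function.comp_apply, Equiv.apply_symm_apply]
            rw [show j - 1 + 1 = j by omega]
          rw [h4]
          rcases Nat.lt_or_ge k (e.symm ⟨j - 1, by omega⟩ : Fin t) with h5 | h5
          · exact Or.inr (hmono (show (⟨k + 1, hk⟩ : Fin t) ≤ _ from h5))
          · exact Or.inl (hmono (show _ ≤ (⟨k, by omega⟩ : Fin t) from h5))
      have h3 : (k + 1 + 1) * (w - 1) = (k + 1) * (w - 1) + (w - 1) := by ring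
      have h4 : w - 1 ≤ (k + 1) * (w - 1) := Nat.le_mul_of_pos_left _ (by omega)
      omega
  have ht : 0 < t := by omega
  calc ∑ k : Fin t, runnerRank p (k + 1) (x (k + 1))
      ≤ ∑ k : Fin t, runnerBound p (y k) :=
        Finset.sum_le_sum fun k _ => runnerRank_le_runnerBound (by omega) (by omega) _
    _ = ∑ k : Fin t, runnerBound p (y (e k)) := (Equiv.sum_comp e _).symm
    _ < ∑ k : Fin t, runnerRank p (k + 1) (maxCharge w (k + 1 : ℕ)) := by
        refine Finset.sum_lt_sum_of_nonempty ⟨⟨0, ht⟩, Finset.mem_univ _⟩ fun k _ => ?_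
        have h1 := hle k k.2
        have h2 : maxCharge w (k + 1 : ℕ) = (((k + 1) * (w - 1) + 1 : ℕ) : ℤ) := by
          rw [maxCharge]
          push_cast [show 1 ≤ w by omega]
          ring
        rw [h2]
        exact runnerBound_lt (by omega) (by omega) (Nat.lt_succ_of_le h1)

/-- Without small absolute values the charge cannot become negative when read backwards from t: a
nonnegative x (i + 1) is at least w (for w = 1 there is no drop at all), and the preceding value is
smaller by at most w - 1. The upper bound adds up the ascents. -/
theorem IsTame.le_maxCharge {t w : ℕ} {x : ℕ → ℤ} (h : IsTame t w x) (hw : 1 ≤ w)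
    (hx : w = 1 ∨ ∀ i, 0 < i → i ≤ t → w ≤ (x i).natAbs) {i : ℕ} (hi : 0 < i) (hit : i ≤ t) :
    0 ≤ x i ∧ x i ≤ maxCharge w i := by
  constructor
  · have down : ∀ k, k < t → 0 ≤ x (t - k) := by
      intro k
      induction k with
      | zero =>
        intro hk
        have h1 := h.last_ge
        rw [Nat.sub_zero]
        rcases hx with hx | hx
        · omega
        · have := hx t hk le_rfl
          omega
      | succ k ih =>
        intro hk
        have h4 := ih (by omega)
        have h6 := h.step_le (t - (k + 1)) (by omega) (by omega)
        rw [show t - (k + 1) + 1 = t - k by omega] at h6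
        rcases hx with hx | hx
        · omega
        · have := hx (t - k) (by omega) (by omega)
          omega
    have := down (t - i) (by omega)
    rwa [show t - (t - i) = i by omega] at this
  · induction i, hi using Nat.le_induction with
    | base => simpa [maxCharge] using h.one_le
    | succ i hi ih =>
      have h1 := ih (by omega)
      have h2 := h.step_le i hi hit
      rw [maxCharge] at *
      push_cast
      have : (0 : ℤ) ≤ w - 1 := by omega
      rcases h2 with h2 | h2 <;> linarith

theorem IsTame.sum_runnerRank_le {p t w : ℕ} (htp : t < p) (hw : 1 ≤ w) {x : ℕ → ℤ}
    (h : IsTame t w x) :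
    ∑ j ∈ Finset.Icc 1 t, runnerRank p j (x j) ≤
      ∑ j ∈ Finset.Icc 1 t, runnerRank p j (maxCharge w j) ∧
    (∑ j ∈ Finset.Icc 1 t, runnerRank p j (x j) =
      ∑ j ∈ Finset.Icc 1 t, runnerRank p j (maxCharge w j) →
      ∀ j, 0 < j → j ≤ t → x j = maxCharge w j) := by
  by_cases hs : w = 1 ∨ ∀ i, 0 < i → i ≤ t → w ≤ (x i).natAbs
  · have key : ∀ j ∈ Finset.Icc 1 t, runnerRank p j (x j) ≤ runnerRank p j (maxCharge w j) := by
      intro j hj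
      rw [Finset.mem_Icc] at hj
      have h1 := h.le_maxCharge hw hs hj.1 hj.2
      exact runnerRank_le_of_le h1.1 h1.2
    refine ⟨Finset.sum_le_sum key, fun heq j hj hjt => ?_⟩
    have h1 := h.le_maxCharge hw hs hj hjt
    by_contra hne
    have h2 := (Finset.sum_eq_sum_iff_of_le key).1 heq j (Finset.mem_Icc.2 ⟨hj, hjt⟩)
    exact (runnerRank_lt_of_lt hj h1.1 (lt_of_le_of_ne h1.2 hne)).ne h2
  · push Not at hs
    obtain ⟨hw1, i, hi, hit, hxi⟩ := hs
    have := h.sum_runnerRank_lt_of_small htp (by omega) hi hit hxi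
    exact ⟨this.le, fun heq => absurd heq this.ne⟩

/-! ### Good nodes of explicit partitions -/

theorem exists_parts_eq {m : Multiset ℕ} (h0 : 0 ∉ m) : ∃ lam : YoungDiagram, parts lam = m := by
  have hs : (m.sort (· ≥ ·)).SortedGE := (Multiset.pairwise_sort m (· ≥ ·)).sortedGE
  refine ⟨YoungDiagram.ofRowLens (m.sort (· ≥ ·)) hs, ?_⟩
  rw [parts, YoungDiagram.rowLens_ofRowLens_eq_self, Multiset.sort_eq]
  intro a ha
  rw [Multiset.mem_sort] at ha
  exact Nat.pos_of_ne_zero fun h => h0 (h ▸ ha)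

theorem mem_parts_iff_exists_rowLen {lam : YoungDiagram} {a : ℕ} (ha : a ≠ 0) :
    a ∈ parts lam ↔ ∃ r, lam.rowLen r = a := by
  simp only [parts, YoungDiagram.rowLens, Multiset.mem_coe, List.mem_map, List.mem_range]
  refine ⟨fun ⟨r, _, h⟩ => ⟨r, h⟩, fun ⟨r, h⟩ => ⟨r, ?_, h⟩⟩
  rw [← YoungDiagram.mem_iff_lt_colLen, YoungDiagram.mem_iff_lt_rowLen]
  omega

/-- The row after one of length a is the longest remaining one, so any shorter part (or 0) within
distance p of a bounds the difference. -/
theorem isRestricted_of_forall_exists {p : ℕ} (hp : 0 < p) {lam : YoungDiagram}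
    (hlam : IsPStrict p (parts lam))
    (h : ∀ a ∈ parts lam, ∃ b, (b = 0 ∨ b ∈ parts lam) ∧ b < a ∧ a ≤ b + p ∧ (p ∣ a → a ≠ b + p)) :
    IsRestricted p lam := by
  refine ⟨hlam, fun r => ?_⟩
  by_cases h0 : lam.rowLen r = 0
  · rw [h0]
    omega
  · obtain ⟨b, hb, hba, h1, h2⟩ := h _ ((mem_parts_iff_exists_rowLen h0).2 ⟨r, rfl⟩)
    have h3 : b ≤ lam.rowLen (r + 1) := by
      by_cases hb0 : b = 0
      · omega
      · obtain ⟨r', hr'⟩ := (mem_parts_iff_exists_rowLen hb0).1 (hb.resolve_left hb0)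
        rw [← hr']
        refine lam.rowLen_anti _ _ ?_
        by_contra! hlt
        have := lam.rowLen_anti r' r (by omega)
        omega
    refine ⟨by omega, fun h4 h5 => ?_⟩
    have := h2 h4
    omega

theorem exists_pairwise_rimBefore (s : Finset (ℕ × ℕ)) :
    ∃ l : List (ℕ × ℕ), l.Pairwise RimBefore ∧ ∀ A, A ∈ l ↔ A ∈ s := by
  classical
  -- The rim order is lexicographic with the row index reversed.
  let f : ℕ × ℕ → ℕᵒᵈ ×ₗ ℕ := fun A => toLex (OrderDual.toDual A.1, A.2)
  let g : ℕᵒᵈ ×ₗ ℕ → ℕ × ℕ := fun A => (OrderDual.ofDual (ofLex A).1, (ofLex A).2)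
  have hgf : ∀ A, g (f A) = A := fun A => rfl
  refine ⟨((s.image f).sort (· ≤ ·)).map g, ?_, fun A => ?_⟩
  · rw [List.pairwise_map]
    refine (Finset.sortedLT_sort (s.image f)).pairwise.imp fun {A B} hAB => ?_
    rcases (Prod.Lex.lt_iff).1 hAB with h | ⟨h1, h2⟩
    · exact Or.inl h
    · exact Or.inr ⟨congrArg OrderDual.ofDual h1, h2⟩
  · simp only [List.mem_map, Finset.mem_sort, Finset.mem_image]
    constructor
    · rintro ⟨_, ⟨B, hB, rfl⟩, rfl⟩
      rwa [hgf]
    · exact fun hA => ⟨f A, ⟨A, hA, rfl⟩, hgf A⟩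

/-- If every minus precedes every plus, the signature has no pair +- to erase; it is its own
reduction, and its last minus is good. -/
theorem isGood_of_last {p i : ℕ} {lam : YoungDiagram} {A : ℕ × ℕ} (hA : IsRemovable p i lam A)
    (hlast : ∀ A', IsRemovable p i lam A' → A' = A ∨ RimBefore A' A) (V : List (ℕ × ℕ))
    (hV : V.Pairwise RimBefore) (hVadd : ∀ B, B ∈ V ↔ IsAddable p i lam B)
    (hAV : ∀ B ∈ V, RimBefore A B) : IsGood p i lam A := by
  classical
  obtain ⟨u, hu, hmem⟩ := exists_pairwise_rimBefore
    (lam.cells.filter fun A' => IsRemovable p i lam A' ∧ A' ≠ A)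
  have hmem' : ∀ A', A' ∈ u ↔ IsRemovable p i lam A' ∧ A' ≠ A := by
    intro A'
    rw [hmem, Finset.mem_filter, YoungDiagram.mem_cells]
    exact ⟨fun h => h.2, fun h => ⟨h.1.1, h⟩⟩
  have huA : ∀ A' ∈ u, RimBefore A' A := fun A' h =>
    (hlast A' ((hmem' A').1 h).1).resolve_left ((hmem' A').1 h).2
  have htrans : ∀ {A B C : ℕ × ℕ}, RimBefore A B → RimBefore B C → RimBefore A C := by
    intro A B C h1 h2
    simp only [RimBefore] at *
    omega
  refine ⟨u.map fun A' => (false, A'), V.map fun B => (true, B), ⟨_, ⟨?_, fun B => ?_, fun B => ?_⟩,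
    Relation.ReflTransGen.refl, ?_⟩, by simp⟩
  · simp only [List.pairwise_append, List.pairwise_cons, List.pairwise_map, List.mem_map,
      List.mem_cons]
    refine ⟨hu, ⟨?_, hV⟩, ?_⟩
    · rintro _ ⟨B, hB, rfl⟩
      exact hAV B hB
    · rintro _ ⟨A', hA', rfl⟩ _ (rfl | ⟨B, hB, rfl⟩)
      · exact huA A' hA'
      · exact htrans (huA A' hA') (hAV B hB)
  · simp [hVadd]
  · simp only [List.mem_append, List.mem_map, List.mem_cons, Prod.mk.injEq, true_and,
      exists_eq_right, hmem', Bool.true_eq_false, false_and, and_false, exists_false, or_false]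
    by_cases hB : B = A
    · simp [hB, hA]
    · simp [hB]
  · rintro R' ⟨u', v', A', B', hS, -⟩
    have hpw : ((u.map fun A' => ((false, A') : SignedNode)) ++
        (false, A) :: V.map fun B => ((true, B) : SignedNode)).Pairwise
          fun x y => x.1 = true → y.1 = true := by
      simp [List.pairwise_append, List.pairwise_cons, List.pairwise_map, List.pairwise_of_forall]
    rw [hS, List.pairwise_append, List.pairwise_cons] at hpw
    simpa using hpw.2.1.1 (false, B')

/-- The rim order is controlled by columns here: at most one addable column remains, and it lies to
the right of all removable ones. -/
theorem isGood_of_columns {p i c : ℕ} (hp3 : 3 ≤ p) (hp : Odd p) {lam : YoungDiagram}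
    (hlam : IsPStrict p (parts lam)) (hc : c + 1 ∈ parts lam) (hc' : c ∉ parts lam ∨ p ∣ c)
    (hres : res p c = i) (hmax : ∀ A, IsRemovable p i lam A → A.2 ≤ c)
    (hadd : (∀ B, ¬ IsAddable p i lam B) ∨
      ∃ d, c < d ∧ IsAddable p i lam (lam.colLen d, d) ∧ ∀ B, IsAddable p i lam B → B.2 = d) :
    IsGood p i lam (lam.colLen c - 1, c) := by
  have hrem := isRemovable_of_mem hlam hc hc' hres
  have hlt := mem_parts.1 hc
  have hlast : ∀ A', IsRemovable p i lam A' →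
      A' = (lam.colLen c - 1, c) ∨ RimBefore A' (lam.colLen c - 1, c) := by
    intro A' hA'
    have h1 := (hA'.props hp).1
    have h2 := hmax A' hA'
    have h3 := lam.colLen_anti _ _ h2
    simp only [Prod.ext_iff, RimBefore]
    rcases h2.eq_or_lt with h4 | h4
    · rw [h4] at h1
      omega
    · omega
  rcases hadd with hadd | ⟨d, hcd, hd, hd'⟩
  · exact isGood_of_last hrem hlast [] List.Pairwise.nil (by simpa using hadd) (by simp)
  · refine isGood_of_last hrem hlast [(lam.colLen d, d)] (List.pairwise_singleton _ _)
      (fun B => ?_) ?_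
    · rw [List.mem_singleton]
      constructor
      · rintro rfl
        exact hd
      · intro hB
        have h1 := hd' B hB
        have h2 := (hB.props hp3 hp).1
        rw [h1] at h2
        exact Prod.ext h2 h1
    · simp only [List.mem_singleton, forall_eq, RimBefore]
      have := lam.colLen_anti (c + 1) d hcd
      omega

theorem exists_crystalEdge {p i c : ℕ} (hp3 : 3 ≤ p) (hp : Odd p) {lam : YoungDiagram}
    {n : Multiset ℕ} (hc0 : 0 < c) (hn : parts lam = (c + 1) ::ₘ n) (hlam : IsRestricted p lam)
    (hmu : ∀ mu, parts mu = c ::ₘ n → IsRestricted p mu)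
    (hc' : c ∉ parts lam ∨ p ∣ c)
    (hres : res p c = i) (hmax : ∀ A, IsRemovable p i lam A → A.2 ≤ c)
    (hadd : (∀ B, ¬ IsAddable p i lam B) ∨
      ∃ d, c < d ∧ IsAddable p i lam (lam.colLen d, d) ∧ ∀ B, IsAddable p i lam B → B.2 = d) :
    ∃ mu, parts mu = c ::ₘ n ∧ CrystalEdge p i mu lam := by
  have hc : c + 1 ∈ parts lam := by rw [hn]; exact Multiset.mem_cons_self _ _
  have hgood := isGood_of_columns hp3 hp hlam.1 hc hc' hres hmax hadd
  obtain ⟨mu, hcells⟩ := exists_erase_cell lam hc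
  obtain ⟨h1, h2⟩ := cells_eq_union_of_cells_eq_sdiff hgood.isRemovable.1 hcells
  have h3 := parts_add_rowPart h1 h2
  rw [hn, rowPart, if_neg hc0.ne', Multiset.cons_add, Multiset.cons_inj_right, add_comm,
    Multiset.singleton_add] at h3
  exact ⟨mu, h3.symm, hmu mu h3.symm, hlam, Or.inr ⟨_, hgood, hcells⟩⟩

/-! ### Blocks that are not external -/

theorem exists_isBarCore_charge {p : ℕ} (hp : Odd p) (z : ℕ → ℤ) :
    ∃ τ, IsBarCore p τ ∧ ∀ j, 0 < j → j ≤ tNum p → charge p τ j = z j := by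
  have hpt := tNum_of_odd hp
  let y : ℕ → ℤ := fun r => if r ≤ tNum p then z r else - z (p - r)
  have hy : IsAntisymm p y := by
    intro r hr0 hr
    simp only [y]
    rcases Nat.lt_or_ge (tNum p) r with h | h
    · rw [if_pos (by omega), if_neg (by omega), neg_neg]
    · rw [if_neg (by omega), if_pos (by omega), show p - (p - r) = r by omega]
  obtain ⟨τ, hτ⟩ := exists_isAbacus p hp.pos y
  refine ⟨τ, hτ.isBarCore hp.pos hy, fun j hj hjt => ?_⟩
  rw [hτ.charge_eq hy hj (by omega)]
  simp [y, hjt]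

theorem IsBarCore.isRestricted {p : ℕ} {τ : Multiset ℕ} (hp : 0 < p) (h : IsBarCore p τ)
    {lam : YoungDiagram} (hlam : parts lam = τ) : IsRestricted p lam := by
  refine isRestricted_of_forall_exists hp (hlam ▸ h.isPStrict) fun a ha => ?_
  rw [hlam] at ha ⊢
  have h1 := h.not_dvd ha
  have h2 := h.pos ha
  rcases Nat.lt_or_ge p a with hpa | hpa
  · refine ⟨a - p, Or.inr (h.mem_of_add_mem (by omega) ?_), by omega, by omega,
      fun h3 => absurd h3 h1⟩
    rwa [Nat.sub_add_cancel hpa.le]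
  · exact ⟨0, Or.inl rfl, h2, by omega, fun h3 => absurd h3 h1⟩

/-- As the loss equals w, the upper neighbour has weight 0 and is the core τ itself. The charge of
`lam₁` identifies its core as ρ and its size identifies its weight as w, so the two crystal edges
enter and leave ρ^w. -/
theorem not_isExternal_of_crystalEdges {p i w : ℕ} (hp3 : 3 ≤ p) (hp : Odd p) (hi : i ≤ tNum p)
    {ρ τ : Multiset ℕ} (hρ : IsBarCore p ρ) (hτ : IsBarCore p τ)
    (hcharge : ∀ j, 0 < j → j ≤ tNum p → charge p τ j = charge p ρ j + bump p i j)
    (hw : edgeLoss p i (charge p ρ) = w) {lam₀ lam₁ lam₂ : YoungDiagram} (h₀ : parts lam₀ = τ)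
    (h₁ : CrystalEdge p i lam₁ lam₀) (h₂ : CrystalEdge p i lam₂ lam₁) : ¬ IsExternal p i ρ w := by
  have hpt := tNum_of_odd hp
  have hB₁ : InBlock p ρ w lam₁ := by
    obtain ⟨v, κ, hκ, hv⟩ := exists_barRemovals hp.pos _ h₁.1.1
    obtain ⟨A, hA, hA', hres⟩ := h₁.exists_cell hp3 hp
    have hκρ : κ = ρ := by
      refine hκ.eq_of_charge_eq hp hρ fun j hj hjt => ?_
      have h1 := charge_of_cells_eq_union hp3 hp hA hA' hj hjt
      rw [h₀, hcharge j hj hjt, hres] at h1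
      rw [← hv.charge_eq hj (by omega)]
      linarith
    subst hκρ
    have h1 := hκ.two_mul_sum hp
    have h2 := hτ.two_mul_sum hp
    rw [sum_runnerRank_congr hcharge] at h2
    have h4 := sum_bump hp3 hp hi (charge p κ)
    rw [← h1, ← h2] at h4
    change _ = 2 + 2 * p * edgeLoss p i (charge p κ) at h4
    have h5 := sum_of_cells_eq_union hA hA'
    have h6 := hv.sum_eq
    rw [h₀, h6] at h5
    have h7 : (τ.sum : ℤ) = κ.sum + p * v + 1 := by exact_mod_cast h5
    have h8 : (p : ℤ) * v = p * w := by
      rw [hw] at h4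
      linarith
    have h9 : v = w := by
      have := mul_left_cancel₀ (by have := hp.pos; positivity) h8
      exact_mod_cast this
    exact ⟨hκ, h₁.1, h9 ▸ hv⟩
  obtain ⟨v, κ, hκ, hv⟩ := exists_barRemovals hp.pos _ h₂.1.1
  rintro (h | h)
  · exact h τ 0 ⟨lam₁, lam₀, hB₁, ⟨hτ, h₁.2.1, h₀⟩, h₁⟩
  · exact h κ v ⟨lam₂, lam₁, ⟨hκ, h₂.1, hv⟩, hB₁, h₂⟩

theorem res_eq_zero {p c : ℕ} (hp : Odd p) (h : res p c = 0) : c % p = 0 ∨ c % p = p - 1 := by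
  have hpt := tNum_of_odd hp
  have h1 := Nat.mod_lt c hp.pos
  rw [res] at h
  split_ifs at h <;> omega

theorem res_of_mod_eq_zero {p c : ℕ} (h : c % p = 0) : res p c = 0 := by
  simp [res, h]

theorem res_of_mod_eq_sub_one {p c : ℕ} (h : c % p = p - 1) : res p c = 0 := by
  rw [res, h]
  split_ifs with h1
  · simp only [tNum] at h1
    omega
  · omega

theorem succ_mod {p c : ℕ} (h : c % p + 1 < p) : (c + 1) % p = c % p + 1 := by
  rw [← Nat.mod_add_mod, Nat.mod_eq_of_lt h]

theorem dvd_succ {p c : ℕ} (hp : 0 < p) (h : c % p = p - 1) : p ∣ c + 1 := by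
  rw [Nat.dvd_iff_mod_eq_zero, ← Nat.mod_add_mod, h, Nat.sub_add_cancel hp, Nat.mod_self]

/-- The neighbour τ above has the w + 1 beads 1, p + 1, ..., p w + 1 on runner 1 and none on runner
p - 1. Its largest such part is shortened twice, p w + 1 → p w → p w - 1, by good nodes. -/
theorem not_isExternal_zero {p w : ℕ} (hp3 : 3 ≤ p) (hp : Odd p) (hw : 1 ≤ w)
    {ρ : Multiset ℕ} (hρ : IsBarCore p ρ) (hx : charge p ρ 1 = w) : ¬ IsExternal p 0 ρ w := by
  have hpt := tNum_of_odd hp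
  have ht := tNum_pos hp3
  obtain ⟨τ, hτ, hcharge⟩ := exists_isBarCore_charge hp fun j => charge p ρ j + bump p 0 j
  have hy1 : charge p τ 1 = w + 1 := by
    rw [hcharge 1 one_pos ht, hx, bump, if_neg ht.ne]
    simp
  have hab := hτ.isAbacus hp
  have hone : ∀ k, 1 + p * k ∈ τ ↔ k ≤ w := by
    intro k
    rw [hab.mem_add_mul one_pos (by omega), hy1]
    omega
  have htop : ∀ a ∈ τ, a % p = 1 → a ≤ p * w + 1 := by
    intro a ha ha1
    rw [← Nat.mod_add_div a p, ha1] at ha ⊢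
    have := Nat.mul_le_mul_left p ((hone _).1 ha)
    omega
  have hsub : ∀ a, a % p = p - 1 → a ∉ τ := by
    intro a ha ha1
    rw [← Nat.mod_add_div a p, ha, hab.mem_add_mul (by omega) (by omega),
      charge_sub (by omega), hy1] at ha1
    generalize a / p = k at ha1
    omega
  have hdvd : ∀ a, a % p = 0 → a ∉ τ := fun a ha ha1 =>
    hτ.not_dvd ha1 (Nat.dvd_of_mod_eq_zero ha)
  have hpw : p ≤ p * w := Nat.le_mul_of_pos_right p hw
  have hmem0 : p * w + 1 ∈ τ := by
    rw [add_comm]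
    exact (hone w).2 le_rfl
  have hmem1 : p * w - p + 1 ∈ τ := by
    have := (hone (w - 1)).2 (by omega)
    rwa [add_comm, Nat.mul_sub, mul_one] at this
  have h1τ : 1 ∈ τ := by simpa using (hone 0).2 (Nat.zero_le w)
  have hmodw : (p * w) % p = 0 := Nat.mul_mod_right p w
  have hmodw' : (p * w - 1) % p = p - 1 := by
    rw [show p * w - 1 = p - 1 + p * (w - 1) by rw [Nat.mul_sub, mul_one]; omega]
    exact add_mul_mod (by omega) _
  obtain ⟨n, hn⟩ := Multiset.exists_cons_of_mem hmem0
  have hnmem : ∀ a, a ∈ n ↔ a ∈ τ ∧ a ≠ p * w + 1 := by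
    intro a
    have h1 : p * w + 1 ∉ n := by
      have := hτ.1.2
      rw [hn, Multiset.nodup_cons] at this
      exact this.1
    rw [hn, Multiset.mem_cons]
    by_cases ha : a = p * w + 1
    · simp [ha, h1]
    · simp [ha]
  have hnstrict : IsPStrict p n := by
    have := hτ.isPStrict
    rw [hn] at this
    exact isPStrict_of_cons this
  -- This covers both shortened partitions, c = p w and c = p w - 1. The part p w - p + 1 is within
  -- p of c, strictly so when c = p w.
  have hrestr : ∀ c, p * w - 1 ≤ c → c ≤ p * w → c ∉ n ∨ p ∣ c → ∀ mu, parts mu = c ::ₘ n →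
      IsRestricted p mu := by
    intro c h1 h2 h3 mu hmu
    refine isRestricted_of_forall_exists hp.pos ?_ ?_
    · rw [hmu]
      exact isPStrict_cons hnstrict (by omega) h3
    · rw [hmu]
      intro a ha
      rcases Multiset.mem_cons.1 ha with rfl | ha
      · exact ⟨p * w - p + 1, Or.inr (Multiset.mem_cons_of_mem ((hnmem _).2 ⟨hmem1, by omega⟩)),
          by omega, by omega, by omega⟩
      · rw [hnmem] at ha
        have h4 := hτ.not_dvd ha.1
        have h5 := hτ.pos ha.1
        rcases Nat.lt_or_ge p a with hpa | hpa
        · have h6 : a - p ∈ τ := hτ.mem_of_add_mem (by omega) (by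
            rw [Nat.sub_add_cancel hpa.le]
            exact ha.1)
          refine ⟨a - p, Or.inr (Multiset.mem_cons_of_mem ((hnmem _).2 ⟨h6, fun h7 => ?_⟩)),
            by omega, by omega, fun h7 => absurd h7 h4⟩
          have h8 := htop a ha.1 (by
            rw [← Nat.sub_add_cancel hpa.le, Nat.add_mod_right, h7, add_comm,
              add_mul_mod (by omega)])
          omega
        · exact ⟨0, Or.inl rfl, h5, by omega, fun h3 => absurd h3 h4⟩
  have hcol : ∀ A : ℕ × ℕ, res p A.2 = 0 → A.2 + 1 ∈ τ ∨ A.2 + 2 ∈ τ ∧ A.2 % p = p - 1 →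
      A.2 ≤ p * w ∧ (A.2 + 1 ∈ τ → A.2 + 1 ≠ p * w + 1 → A.2 ≤ p * w - 1) ∧
      (A.2 + 2 ∈ τ ∧ A.2 % p = p - 1 → A.2 ≤ p * w - 1) := by
    intro A hA h
    have h1 : A.2 + 1 ∈ τ → A.2 ≤ p * w := by
      intro h1
      rcases res_eq_zero hp hA with h2 | h2
      · have := htop _ h1 (by rw [succ_mod (by omega), h2])
        omega
      · exact absurd (dvd_succ hp.pos h2) (hτ.not_dvd h1)
    have h2 : A.2 + 2 ∈ τ ∧ A.2 % p = p - 1 → A.2 ≤ p * w - 1 := by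
      rintro ⟨h2, h3⟩
      have h4 := Nat.mod_eq_zero_of_dvd (dvd_succ hp.pos h3)
      have := htop _ h2 (by
        rw [show A.2 + 2 = A.2 + 1 + 1 from rfl, succ_mod (by omega), h4])
      omega
    refine ⟨?_, fun h3 h4 => ?_, h2⟩
    · rcases h with h | h
      · exact h1 h
      · have := h2 h
        omega
    · have := h1 h3
      omega
  obtain ⟨lam₀, h₀⟩ := exists_parts_eq hτ.1.1
  have hw0 : p * w - 1 + 1 = p * w := by omega
  obtain ⟨lam₁, h₁, he₁⟩ := exists_crystalEdge (i := 0) (c := p * w) hp3 hp (by omega)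
    (h₀.trans hn) (hτ.isRestricted hp.pos h₀)
    (hrestr _ (by omega) le_rfl (Or.inr (dvd_mul_right p w))) (Or.inr (dvd_mul_right p w))
    (res_of_mod_eq_zero hmodw) (fun A hA => by
      obtain ⟨-, h1, h2⟩ := hA.props hp
      rw [h₀] at h2
      exact (hcol A h1 (by tauto)).1)
    (Or.inl fun B hB => by
      obtain ⟨-, h1, h2⟩ := hB.props hp3 hp
      rw [h₀] at h2
      rcases h2 with ⟨h2 | h2, h3⟩ | ⟨c, hc, -, h2, -⟩
      · rw [h2, zero_add] at h3
        rcases h3 with h3 | h3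
        · exact h3 h1τ
        · have := Nat.le_of_dvd one_pos h3
          omega
      · rcases res_eq_zero hp h1 with h4 | h4
        · exact hdvd _ h4 h2
        · exact hsub _ h4 h2
      · exact hsub _ h2 hc)
  have hp1 : ∀ a, a ∈ parts lam₁ ↔ a = p * w ∨ (a ∈ τ ∧ a ≠ p * w + 1) := by
    intro a
    rw [h₁, Multiset.mem_cons, hnmem]
  -- The node just removed, in column p w, is now the only addable one; it lies to the right of
  -- column p w - 1 and cancels nothing.
  obtain ⟨lam₂, h₂, he₂⟩ := exists_crystalEdge (i := 0) (c := p * w - 1) (lam := lam₁) hp3 hp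
    (by omega) (by rw [h₁, hw0]) he₁.1
    (hrestr _ le_rfl (by omega) (Or.inl fun h => hsub _ hmodw' ((hnmem _).1 h).1))
    (Or.inl (by
      rw [hp1]
      rintro (h | ⟨h, -⟩)
      · omega
      · exact hsub _ hmodw' h))
    (res_of_mod_eq_sub_one hmodw') (fun A hA => by
      obtain ⟨-, h1, h2⟩ := hA.props hp
      rw [hp1, hp1, hp1] at h2
      rcases h2 with ⟨h2 | h2, -⟩ | ⟨h2 | h2, h3, -⟩
      · omega
      · exact (hcol A h1 (Or.inl h2.1)).2.1 h2.1 h2.2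
      · omega
      · exact (hcol A h1 (Or.inr ⟨h2.1, h3⟩)).2.2 ⟨h2.1, h3⟩)
    (Or.inr ⟨p * w, by omega, isAddable_of_mem he₁.1.1 ((hp1 _).2 (Or.inl rfl))
      (Or.inl (by rw [hp1]; simp)) (res_of_mod_eq_zero hmodw), fun B hB => by
      obtain ⟨-, h1, h2⟩ := hB.props hp3 hp
      rw [hp1, hp1] at h2
      rcases h2 with ⟨h2 | h2 | h2, h3⟩ | ⟨c, hc, -, h2, -⟩
      · rw [h2, zero_add] at h3
        rcases h3 with h3 | h3
        · exact absurd (Or.inr ⟨h1τ, by omega⟩) h3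
        · have := Nat.le_of_dvd one_pos h3
          omega
      · exact h2
      · rcases res_eq_zero hp h1 with h4 | h4
        · exact absurd h2.1 (hdvd _ h4)
        · exact absurd h2.1 (hsub _ h4)
      · rcases (hp1 c).1 hc with hc | hc
        · rw [hc, hmodw] at h2
          omega
        · exact absurd hc.1 (hsub _ h2)⟩)
  refine not_isExternal_of_crystalEdges hp3 hp (Nat.zero_le _) hρ hτ hcharge ?_ h₀ he₁ he₂
  rw [edgeLoss, if_pos rfl, hx]

theorem exists_two_greatest {S : Finset ℕ} (hS : ∃ a ∈ S, ∃ b ∈ S, a ≠ b) :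
    ∃ a ∈ S, ∃ b ∈ S, b < a ∧ ∀ c ∈ S, c = a ∨ c ≤ b := by
  obtain ⟨a, ha, b, hb, hab⟩ := hS
  have hne : S.Nonempty := ⟨a, ha⟩
  have hne' : (S.erase (S.max' hne)).Nonempty := by
    by_cases h : a = S.max' hne
    · exact ⟨b, Finset.mem_erase.2 ⟨fun h' => hab (h.trans h'.symm), hb⟩⟩
    · exact ⟨a, Finset.mem_erase.2 ⟨h, ha⟩⟩
  have h1 := Finset.mem_erase.1 ((S.erase (S.max' hne)).max'_mem hne')
  refine ⟨_, S.max'_mem hne, _, h1.2, lt_of_le_of_ne (S.le_max' _ h1.2) h1.1, fun c hc => ?_⟩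
  by_cases h : c = S.max' hne
  · exact Or.inl h
  · exact Or.inr (Finset.le_max' _ _ (Finset.mem_erase.2 ⟨h, hc⟩))

theorem res_eq_iff {p i c : ℕ} (hp : Odd p) (hi : i ≤ tNum p) :
    res p c = i ↔ c % p = i ∨ c % p + i + 1 = p := by
  have hpt := tNum_of_odd hp
  have h1 := Nat.mod_lt c hp.pos
  rw [res]
  split_ifs <;> omega

/-- Since x_{i+1} exceeds x_i by w + 1 ≥ 2, runner i + 1 reaches above runner i and runner p - i
above runner p - i - 1 by w + 1 beads in total. Each of these beads gives a removable column, and no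
column is addable. -/
theorem exists_two_removable_columns {p i w : ℕ} (hp : Odd p) (hi0 : 0 < i)
    (hi : i < tNum p) (hw : 1 ≤ w) {τ : Multiset ℕ} (hτ : IsBarCore p τ)
    (hy : charge p τ (i + 1) - charge p τ i = w + 1) :
    (∀ c ∈ τ, res p c = i → c + 1 ∈ τ) ∧
    ∃ c₀ c₁, c₁ < c₀ ∧ (c₀ + 1 ∈ τ ∧ c₀ ∉ τ ∧ res p c₀ = i) ∧
      (c₁ + 1 ∈ τ ∧ c₁ ∉ τ ∧ res p c₁ = i) ∧
      ∀ c, c + 1 ∈ τ → c ∉ τ → res p c = i → c = c₀ ∨ c ≤ c₁ := by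
  have hpt := tNum_of_odd hp
  have hab := hτ.isAbacus hp
  have m1 : ∀ k, i + p * k ∈ τ ↔ (k : ℤ) < charge p τ i := fun k =>
    hab.mem_add_mul hi0 (by omega) k
  have m2 : ∀ k, i + p * k + 1 ∈ τ ↔ (k : ℤ) < charge p τ (i + 1) := fun k => by
    rw [← hab.mem_add_mul (by omega) (by omega) k, add_right_comm]
  have m3 : ∀ k, p - (i + 1) + p * k ∈ τ ↔ (k : ℤ) < - charge p τ (i + 1) := fun k => by
    rw [hab.mem_add_mul (by omega) (by omega) k, charge_sub (by omega)]
  have m4 : ∀ k, p - (i + 1) + p * k + 1 ∈ τ ↔ (k : ℤ) < - charge p τ i := fun k => by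
    rw [← charge_sub (by omega), ← hab.mem_add_mul (by omega) (by omega) k]
    rw [show p - i = p - (i + 1) + 1 by omega, add_right_comm]
  have r1 : ∀ k, res p (i + p * k) = i := fun k => by
    rw [res_eq_iff hp hi.le, add_mul_mod (by omega)]
    exact Or.inl rfl
  have r2 : ∀ k, res p (p - (i + 1) + p * k) = i := fun k => by
    rw [res_eq_iff hp hi.le, add_mul_mod (by omega)]
    omega
  constructor
  · intro c hc hres
    rw [res_eq_iff hp hi.le] at hres
    rw [← Nat.mod_add_div c p] at hc ⊢
    rcases hres with h | h
    · rw [h, m1] at hc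
      rw [h, m2]
      omega
    · rw [show c % p = p - (i + 1) by omega, m3] at hc
      rw [show c % p = p - (i + 1) by omega, m4]
      omega
  · classical
    let S : Finset ℕ := (τ.toFinset.image fun a => a - 1).filter fun c =>
      c + 1 ∈ τ ∧ c ∉ τ ∧ res p c = i
    have hS : ∀ c, c ∈ S ↔ c + 1 ∈ τ ∧ c ∉ τ ∧ res p c = i := by
      intro c
      simp only [S, Finset.mem_filter, Finset.mem_image, Multiset.mem_toFinset,
        and_iff_right_iff_imp]
      exact fun h => ⟨c + 1, h.1, rfl⟩
    have s1 : ∀ k : ℕ, (k : ℤ) < charge p τ (i + 1) → charge p τ i ≤ k → i + p * k ∈ S :=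
      fun k h1 h2 => (hS _).2 ⟨(m2 k).2 h1, fun h => by have := (m1 k).1 h; omega, r1 k⟩
    have s2 : ∀ k : ℕ, (k : ℤ) < - charge p τ i → - charge p τ (i + 1) ≤ k →
        p - (i + 1) + p * k ∈ S :=
      fun k h1 h2 => (hS _).2 ⟨(m4 k).2 h1, fun h => by have := (m3 k).1 h; omega, r2 k⟩
    have hinj : ∀ (r r' k l : ℕ), r < p → r' < p → r + p * k = r' + p * l → r = r' ∧ k = l := by
      intro r r' k l hr hr' h
      have h1 := add_mul_mod hr k
      have h2 := add_mul_div hr k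
      rw [h, add_mul_mod hr'] at h1
      rw [h, add_mul_div hr'] at h2
      exact ⟨h1.symm, h2.symm⟩
    -- Two witnesses suffice: both on runner i when x_i ≥ 0, both on runner p - i - 1 when x_{i+1} ≤
    -- 0, and one on each otherwise.
    obtain ⟨c₀, h0, c₁, h1, hlt, hmax⟩ := exists_two_greatest (S := S) (by
      generalize charge p τ (i + 1) = u at *
      generalize charge p τ i = v at *
      rcases le_or_gt 0 v with hv | hv
      · refine ⟨_, s1 (u - 1).toNat (by omega) (by omega), _,
          s1 (u - 2).toNat (by omega) (by omega), fun h => ?_⟩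
        have := hinj _ _ _ _ (by omega) (by omega) h
        omega
      · rcases le_or_gt u 0 with hu | hu
        · refine ⟨_, s2 (-v - 1).toNat (by omega) (by omega), _,
            s2 (-v - 2).toNat (by omega) (by omega), fun h => ?_⟩
          have := hinj _ _ _ _ (by omega) (by omega) h
          omega
        · refine ⟨_, s1 (u - 1).toNat (by omega) (by omega), _,
            s2 (-v - 1).toNat (by omega) (by omega), fun h => ?_⟩
          have := hinj _ _ _ _ (by omega) (by omega) h
          omega)
    exact ⟨c₀, c₁, hlt, (hS _).1 h0, (hS _).1 h1, fun c h h' h'' => hmax c ((hS c).2 ⟨h, h', h''⟩)⟩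

/-- The core τ above the block has only minus signs for residue i, at least two of them. The nodes
in the two rightmost removable columns c₀ > c₁ are good in succession: after the first removal the
only plus is at c₀, behind all minuses. -/
theorem not_isExternal_of_lt {p i w : ℕ} (hp3 : 3 ≤ p) (hp : Odd p) (hw : 1 ≤ w) (hi0 : 0 < i)
    (hi : i < tNum p) {ρ : Multiset ℕ} (hρ : IsBarCore p ρ)
    (hx : charge p ρ (i + 1) - charge p ρ i = w - 1) : ¬ IsExternal p i ρ w := by
  have hpt := tNum_of_odd hp
  obtain ⟨τ, hτ, hcharge⟩ := exists_isBarCore_charge hp fun j => charge p ρ j + bump p i j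
  have hy : charge p τ (i + 1) - charge p τ i = w + 1 := by
    rw [hcharge _ (by omega) (by omega), hcharge _ hi0 hi.le, bump, bump, if_neg hi.ne,
      if_neg hi.ne]
    simp
    omega
  obtain ⟨hup, c₀, c₁, hlt, ⟨hc₀, hc₀', hr₀⟩, ⟨hc₁, hc₁', hr₁⟩, hmax⟩ :=
    exists_two_removable_columns hp hi0 hi hw hτ hy
  -- For 0 < i < t the columns of residue i are never adjacent and involve no multiple of p, so all
  -- exceptions for repeated parts disappear.
  have hndvd : ∀ c, res p c = i → ¬ p ∣ c ∧ ¬ p ∣ c + 1 ∧ res p (c + 1) ≠ i ∧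
      res p (c + p) = i := by
    intro c hc
    rw [ne_eq, res_eq_iff hp hi.le, res_eq_iff hp hi.le, Nat.add_mod_right,
      Nat.dvd_iff_mod_eq_zero, Nat.dvd_iff_mod_eq_zero]
    rw [res_eq_iff hp hi.le] at hc
    rw [succ_mod (by omega)]
    omega
  have d₀ := hndvd _ hr₀
  have d₁ := hndvd _ hr₁
  have hne : c₁ + 1 ≠ c₀ := fun h => d₁.2.2.1 (h ▸ hr₀)
  have pos : ∀ c, ¬ p ∣ c → 0 < c ∧ c ≠ p := fun c hc =>
    ⟨Nat.pos_of_ne_zero fun h => hc (h ▸ dvd_zero p), fun h => hc (h ▸ dvd_rfl)⟩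
  have e₀ := pos _ d₀.1
  have e₁ := pos _ d₁.1
  have f₀ := pos _ d₀.2.1
  have f₁ := pos _ d₁.2.1
  have hsub : ∀ a ∈ τ, p < a → a - p ∈ τ := fun a ha hpa =>
    hτ.mem_of_add_mem (by omega) (by rwa [Nat.sub_add_cancel hpa.le])
  obtain ⟨n, hn⟩ := Multiset.exists_cons_of_mem hc₀
  have hc₁n : c₁ + 1 ∈ n := by
    rw [hn, Multiset.mem_cons] at hc₁
    exact hc₁.resolve_left (by omega)
  obtain ⟨m, rfl⟩ := Multiset.exists_cons_of_mem hc₁n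
  have hnd := hτ.1.2
  rw [hn, Multiset.nodup_cons, Multiset.nodup_cons, Multiset.mem_cons, not_or] at hnd
  have hm : ∀ a, a ∈ m ↔ a ∈ τ ∧ a ≠ c₀ + 1 ∧ a ≠ c₁ + 1 := by
    intro a
    rw [hn, Multiset.mem_cons, Multiset.mem_cons]
    constructor
    · exact fun h => ⟨Or.inr (Or.inr h), fun h' => hnd.1.2 (h' ▸ h), fun h' => hnd.2.1 (h' ▸ h)⟩
    · tauto
  have hn1 : ∀ a, a ∈ (c₁ + 1) ::ₘ m ↔ a ∈ τ ∧ a ≠ c₀ + 1 := by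
    intro a
    rw [Multiset.mem_cons, hm]
    constructor
    · rintro (rfl | h)
      · exact ⟨hc₁, by omega⟩
      · exact ⟨h.1, h.2.1⟩
    · tauto
  have hτm : ∀ a ∈ τ, ¬ p ∣ a ∧ 0 < a ∧ a ≠ p := fun a ha =>
    ⟨hτ.not_dvd ha, pos _ (hτ.not_dvd ha)⟩
  have hstrict : IsPStrict p ((c₁ + 1) ::ₘ m) := by
    have := hτ.isPStrict
    rw [hn] at this
    exact isPStrict_of_cons this
  have hstrict₁ : IsPStrict p (c₀ ::ₘ (c₁ + 1) ::ₘ m) :=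
    isPStrict_cons hstrict e₀.1 (Or.inl fun h => hc₀' ((hn1 _).1 h).1)
  have hstrict₂ : IsPStrict p (c₁ ::ₘ c₀ ::ₘ m) := by
    refine isPStrict_cons (isPStrict_cons (isPStrict_of_cons hstrict) e₀.1
      (Or.inl fun h => hc₀' ((hm _).1 h).1)) e₁.1 (Or.inl fun h => ?_)
    rcases Multiset.mem_cons.1 h with h | h
    · omega
    · exact hc₁' ((hm _).1 h).1
  -- If c₀ + 1 + p is a part that relied on the shortened part c₀ + 1 for restrictedness, maximality
  -- of c₀ supplies the part c₀ + p in its place.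
  have hshift₀ : c₀ + p ∈ τ ∨ c₀ + 1 + p ∉ τ := by
    by_contra! h
    have := hmax (c₀ + p) (by rw [add_right_comm]; exact h.2) h.1 d₀.2.2.2
    omega
  have hshift₁ : c₁ + p ∈ τ ∨ c₁ + 1 + p ∉ τ ∨ c₁ + p = c₀ := by
    by_contra! h
    have := hmax (c₁ + p) (by rw [add_right_comm]; exact h.2.1) h.1 d₁.2.2.2
    omega
  have hne' : c₁ + p ≠ c₀ + 1 := fun h => d₀.2.2.1 (h ▸ d₁.2.2.2)
  have hrestr₁ : ∀ mu, parts mu = c₀ ::ₘ (c₁ + 1) ::ₘ m → IsRestricted p mu := by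
    intro mu hmu
    refine isRestricted_of_forall_exists hp.pos (hmu ▸ hstrict₁) ?_
    intro a ha
    have hmu' : ∀ b, b ∈ parts mu ↔ b = c₀ ∨ (b ∈ τ ∧ b ≠ c₀ + 1) := fun b => by
      rw [hmu, Multiset.mem_cons, hn1]
    simp only [hmu'] at ha ⊢
    rcases Nat.lt_or_ge a p with hap | hap
    · refine ⟨0, Or.inl rfl, ?_, by omega, by omega⟩
      rcases ha with ha | ha
      · omega
      · exact (hτm a ha.1).2.1
    rcases ha with rfl | ⟨ha, ha'⟩
    · exact ⟨a + 1 - p, Or.inr (Or.inr ⟨hsub _ hc₀ (by omega), by omega⟩), by omega, by omega,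
        fun h => absurd h d₀.1⟩
    · have ht := hτm a ha
      have h1 := hsub a ha (by omega)
      by_cases h2 : a - p = c₀ + 1
      · have h3 : c₀ + p ∈ τ := hshift₀.resolve_right fun h => h (by
          rwa [← h2, Nat.sub_add_cancel hap])
        exact ⟨c₀ + p, Or.inr (Or.inr ⟨h3, by omega⟩), by omega, by omega,
          fun h => absurd h ht.1⟩
      · exact ⟨a - p, Or.inr (Or.inr ⟨h1, h2⟩), by omega, by omega, fun h => absurd h ht.1⟩
  have hrestr₂ : ∀ mu, parts mu = c₁ ::ₘ c₀ ::ₘ m → IsRestricted p mu := by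
    intro mu hmu
    refine isRestricted_of_forall_exists hp.pos (hmu ▸ hstrict₂) ?_
    intro a ha
    have hmu' : ∀ b, b ∈ parts mu ↔ b = c₁ ∨ b = c₀ ∨ (b ∈ τ ∧ b ≠ c₀ + 1 ∧ b ≠ c₁ + 1) :=
      fun b => by rw [hmu, Multiset.mem_cons, Multiset.mem_cons, hm]
    simp only [hmu'] at ha ⊢
    rcases Nat.lt_or_ge a p with hap | hap
    · refine ⟨0, Or.inl rfl, ?_, by omega, by omega⟩
      rcases ha with ha | ha | ha
      · omega
      · omega
      · exact (hτm a ha.1).2.1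
    rcases ha with rfl | rfl | ⟨ha, ha', ha''⟩
    · exact ⟨a + 1 - p, Or.inr (Or.inr (Or.inr ⟨hsub _ hc₁ (by omega), by omega, by omega⟩)),
        by omega, by omega, fun h => absurd h d₁.1⟩
    · by_cases h2 : a + 1 - p = c₁ + 1
      · exact ⟨c₁, Or.inr (Or.inl rfl), by omega, by omega, fun h => absurd h d₀.1⟩
      · exact ⟨a + 1 - p, Or.inr (Or.inr (Or.inr ⟨hsub _ hc₀ (by omega), by omega, by omega⟩)),
          by omega, by omega, fun h => absurd h d₀.1⟩
    · have ht := hτm a ha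
      have h1 := hsub a ha (by omega)
      by_cases h2 : a - p = c₀ + 1
      · have h3 : c₀ + p ∈ τ := hshift₀.resolve_right fun h => h (by
          rwa [← h2, Nat.sub_add_cancel hap])
        exact ⟨c₀ + p, Or.inr (Or.inr (Or.inr ⟨h3, by omega, by omega⟩)), by omega, by omega,
          fun h => absurd h ht.1⟩
      · by_cases h4 : a - p = c₁ + 1
        · have h3 : c₁ + p ∈ τ := by
            rcases hshift₁ with h | h | h
            · exact h
            · exact absurd (by rwa [← h4, Nat.sub_add_cancel hap]) h
            · omega
          exact ⟨c₁ + p, Or.inr (Or.inr (Or.inr ⟨h3, by omega, by omega⟩)), by omega, by omega,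
            fun h => absurd h ht.1⟩
        · exact ⟨a - p, Or.inr (Or.inr (Or.inr ⟨h1, h2, h4⟩)), by omega, by omega,
            fun h => absurd h ht.1⟩
  have hadd0 : ∀ {lam : YoungDiagram} {B : ℕ × ℕ}, IsAddable p i lam B →
      res p B.2 = i ∧ B.2 ∈ parts lam ∧ B.2 + 1 ∉ parts lam := by
    intro lam B hB
    obtain ⟨-, h1, h2⟩ := hB.props hp3 hp
    have d := hndvd _ h1
    have e := pos _ d.1
    rcases h2 with ⟨h2, h3⟩ | ⟨c, -, -, -, h2⟩
    · exact ⟨h1, h2.resolve_left (by omega), h3.resolve_right d.2.1⟩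
    · omega
  have hrem0 : ∀ {lam : YoungDiagram} {A : ℕ × ℕ}, IsRemovable p i lam A →
      res p A.2 = i ∧ A.2 + 1 ∈ parts lam ∧ A.2 ∉ parts lam := by
    intro lam A hA
    obtain ⟨-, h1, h2⟩ := hA.props hp
    rcases h2 with ⟨h2, h3⟩ | ⟨-, -, h2⟩
    · exact ⟨h1, h2, h3.resolve_right (hndvd _ h1).1⟩
    · omega
  obtain ⟨lam₀, h₀⟩ := exists_parts_eq hτ.1.1
  obtain ⟨lam₁, h₁, he₁⟩ := exists_crystalEdge (i := i) (c := c₀) hp3 hp e₀.1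
    (h₀.trans hn) (hτ.isRestricted hp.pos h₀) hrestr₁ (Or.inl (h₀ ▸ hc₀')) hr₀
    (fun A hA => by
      obtain ⟨h1, h2, h3⟩ := hrem0 hA
      rw [h₀] at h2 h3
      have := hmax _ h2 h3 h1
      omega)
    (Or.inl fun B hB => by
      obtain ⟨h1, h2, h3⟩ := hadd0 hB
      rw [h₀] at h2 h3
      exact h3 (hup _ h2 h1))
  have hmem₁ : ∀ b, b ∈ parts lam₁ ↔ b = c₀ ∨ (b ∈ τ ∧ b ≠ c₀ + 1) := fun b => by
    rw [h₁, Multiset.mem_cons, hn1]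
  obtain ⟨lam₂, h₂, he₂⟩ := exists_crystalEdge (i := i) (c := c₁) (lam := lam₁) hp3 hp e₁.1
    (h₁.trans (Multiset.cons_swap _ _ _)) he₁.1 hrestr₂
    (Or.inl (by rw [hmem₁]; rintro (h | h); exacts [by omega, hc₁' h.1])) hr₁
    (fun A hA => by
      obtain ⟨h1, h2, h3⟩ := hrem0 hA
      have d := hndvd _ h1
      rw [hmem₁] at h2 h3
      rcases h2 with h2 | h2
      · exact absurd (h2 ▸ hr₀) d.2.2.1
      · have h4 : A.2 ∉ τ := fun h => h3 (Or.inr ⟨h, fun h' => d₀.2.2.1 (h' ▸ h1)⟩)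
        have := hmax _ h2.1 h4 h1
        omega)
    (Or.inr ⟨c₀, hlt, isAddable_of_mem he₁.1.1 ((hmem₁ _).2 (Or.inl rfl))
      (Or.inl (by rw [hmem₁]; simp)) hr₀, fun B hB => by
      obtain ⟨h1, h2, h3⟩ := hadd0 hB
      rw [hmem₁] at h2 h3
      rcases h2 with h2 | h2
      · exact h2
      · have h4 := hup _ h2.1 h1
        by_contra h5
        exact h3 (Or.inr ⟨h4, by omega⟩)⟩)
  refine not_isExternal_of_crystalEdges hp3 hp hi.le hρ hτ hcharge ?_ h₀ he₁ he₂
  rw [edgeLoss, if_neg hi0.ne', if_neg hi.ne, hx]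
  ring

/-! ### The extremal block cannot be reduced -/

/-- The numbers `r 1 < r 2 < ⋯ < r t` describe how a charge `x` arises from the charge of the
extremal block by the affine Weyl group. -/
structure IsConfiguration (p w : ℕ) (x : ℕ → ℤ) (r : ℕ → ℕ) : Prop where
  not_dvd : ∀ i, 0 < i → i ≤ tNum p → ¬ p ∣ r i
  lt_succ : ∀ i, 0 < i → i < tNum p → r i < r (i + 1)
  mod_ne : ∀ i j, 0 < i → i < j → j ≤ tNum p → r i % p ≠ r j % p ∧ r i % p + r j % p ≠ p
  charge_eq : ∀ i, 0 < i → i ≤ tNum p → x (r i % p) = maxCharge w i + (r i / p : ℕ)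

/-- The sequence increases strictly, and r 1 ≥ 1 because p divides 0. -/
theorem IsConfiguration.le {p w : ℕ} {x : ℕ → ℤ} {r : ℕ → ℕ} (h : IsConfiguration p w x r) {i : ℕ}
    (hi : 0 < i) (hit : i ≤ tNum p) : i ≤ r i := by
  induction i, hi using Nat.le_induction with
  | base => exact Nat.pos_of_ne_zero fun h0 => h.not_dvd 1 one_pos hit (h0 ▸ dvd_zero p)
  | succ i hi ih =>
    have h1 := ih (by omega)
    have h2 := h.lt_succ i hi hit
    omega

theorem isConfiguration_id {p w : ℕ} (hp : Odd p) {x : ℕ → ℤ}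
    (h : ∀ j, 0 < j → j ≤ tNum p → x j = maxCharge w j) : IsConfiguration p w x id := by
  have hpt := tNum_of_odd hp
  refine ⟨fun i hi hit hd => ?_, fun i _ _ => Nat.lt_succ_self i, fun i j hi hij hjt => ?_,
    fun i hi hit => ?_⟩
  · have := Nat.le_of_dvd hi hd
    omega
  · simp only [id]
    rw [Nat.mod_eq_of_lt (by omega), Nat.mod_eq_of_lt (by omega)]
    omega
  · simp only [id]
    rw [Nat.mod_eq_of_lt (by omega), Nat.div_eq_of_lt (by omega), h i hi hit]
    simp

theorem maxCharge_succ_sub (w i : ℕ) : maxCharge w (i + 1) - maxCharge w i = w - 1 := by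
  simp only [maxCharge]
  push_cast
  ring

/-- K_q permutes the integers r_i along with the runners. Only an exchange of two consecutive values
could destroy their order, and externality excludes this. -/
theorem IsConfiguration.swapRunners {p w q : ℕ} (hp3 : 3 ≤ p) (hp : Odd p) (hw : 1 ≤ w)
    (hq0 : 0 < q) (hq : q ≤ tNum p) {ρ : Multiset ℕ} (hρ : IsBarCore p ρ) {r : ℕ → ℕ}
    (h : IsConfiguration p w (charge p ρ) r) (hext : IsExternal p q ρ w) :
    IsConfiguration p w (charge p (SpinBlock.scopes p q ρ))
      fun i => SpinBlock.swapRunners p q (r i) := by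
  have hpt := tNum_of_odd hp
  have hq2 : 2 * q < p ∧ p % 2 = 1 := by omega
  refine ⟨fun i hi hit => ?_, fun i hi hit => ?_, fun i j hi hij hjt => ?_, fun i hi hit => ?_⟩
  · rw [dvd_swapRunners hq0 hq2]
    exact h.not_dvd i hi hit
  · by_contra! hc
    have h1 := h.lt_succ i hi hit
    have e1 := h.charge_eq i hi hit.le
    have e2 := h.charge_eq (i + 1) (by omega) hit
    have e3 := maxCharge_succ_sub w i
    have e4 := h.mod_ne i (i + 1) hi (by omega) hit
    generalize r i = a at *
    generalize r (i + 1) = b at *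
    have h2 : SpinBlock.swapRunners p q b ≠ SpinBlock.swapRunners p q a := fun h' => by
      have := congrArg (SpinBlock.swapRunners p q) h'
      rw [swapRunners_swapRunners hq0 hq2, swapRunners_swapRunners hq0 hq2] at this
      omega
    have ha := Nat.mod_lt a hp.pos
    have hb := Nat.mod_lt b hp.pos
    have a1 := swapRunners_cases ha hq2
    have b1 := swapRunners_cases hb hq2
    have a2 := swapRunners_add_mul ha hq0 (a / p)
    have b2 := swapRunners_add_mul hb hq0 (b / p)
    have a3 := Nat.mod_add_div a p
    have b3 := Nat.mod_add_div b p
    rw [a3] at a2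
    rw [b3] at b2
    -- Each value moves by at most 1, so the order flips only if neighbours a and a + 1 are
    -- exchanged. Equal levels then give x_{q+1} - x_q = w - 1, the excluded non-external case; q =
    -- t is ruled out by `mod_ne`.
    have hab : b = a + 1 := by omega
    have hm : b % p = a % p + 1 := by rw [hab, succ_mod (by omega)]
    have hd : b / p = a / p := by
      have : p * (b / p) = p * (a / p) := by omega
      exact Nat.eq_of_mul_eq_mul_left hp.pos this
    rw [hd, hm] at e2
    have hqt : q < tNum p := by omega
    refine not_isExternal_of_lt hp3 hp hw hq0 hqt hρ ?_ hext
    have hcase : a % p = q ∨ a % p + q + 1 = p := by omega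
    rcases hcase with h5 | h5
    · rw [h5] at e1 e2
      omega
    · rw [show a % p = p - (q + 1) by omega, charge_sub (by omega)] at e1
      rw [show a % p + 1 = p - q by omega, charge_sub (by omega)] at e2
      omega
  · have h1 := h.mod_ne i j hi hij hjt
    rw [swapRunners_mod hq0 hq2, swapRunners_mod hq0 hq2]
    have a1 := swapRunners_cases (Nat.mod_lt (r i) hp.pos) hq2
    have b1 := swapRunners_cases (Nat.mod_lt (r j) hp.pos) hq2
    have a0 := Nat.mod_lt (r i) hp.pos
    have b0 := Nat.mod_lt (r j) hp.pos
    omega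
  · have hr0 := mod_pos_of_not_dvd (h.not_dvd i hi hit)
    have hr := Nat.mod_lt (r i) hp.pos
    rw [swapRunners_div hq0 hq2, swapRunners_mod hq0 hq2, hρ.charge_scopes hp3 hp hq
      (swapRunners_pos hr0 hr hq0 hq2) (swapRunners_lt hr hq0 hq2), reflect, if_neg hq0.ne',
      swapRunners_swapRunners_of_lt hr hq0 hq2]
    exact h.charge_eq i hi hit

theorem swapZero_cases {p a : ℕ} (hp3 : 3 ≤ p) (ha : a ≠ 1) :
    (a % p = 1 ∧ swapZero p a % p = p - 1 ∧ swapZero p a / p + 1 = a / p ∧ swapZero p a + 2 = a) ∨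
    (a % p = p - 1 ∧ swapZero p a % p = 1 ∧ swapZero p a / p = a / p + 1 ∧
      swapZero p a = a + 2) ∨
    (a % p ≠ 1 ∧ a % p ≠ p - 1 ∧ swapZero p a = a) := by
  obtain ⟨s, k, hs, rfl⟩ := exists_eq_add_mul (show 0 < p by omega) a
  by_cases h1 : s = 1
  · subst h1
    obtain ⟨k, rfl⟩ : ∃ l, k = l + 1 := Nat.exists_eq_succ_of_ne_zero (by rintro rfl; simp at ha)
    left
    rw [swapZero_one_add_mul hp3, add_mul_mod hs, add_mul_mod (by omega), add_mul_div hs,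
      add_mul_div (by omega), one_add_mul_succ hp3]
    simp
  · by_cases h2 : s = p - 1
    · subst h2
      right; left
      rw [swapZero_sub_one_add_mul hp3, add_mul_mod hs, add_mul_mod (by omega), add_mul_div hs,
        add_mul_div (by omega), one_add_mul_succ hp3]
      simp
    · right; right
      rw [swapZero_add_mul hs h1 h2, add_mul_mod hs]
      simp [h1, h2]

/-- The integer 1 would be reflected to -1, but r_i = 1 forces i = 1 and x_1 = w, where K_0 is not
allowed. Elsewhere K_0 exchanges only k p - 1 and k p + 1, which do not both occur among the r_i. -/
theorem IsConfiguration.swapZero {p w : ℕ} (hp3 : 3 ≤ p) (hp : Odd p) (hw : 1 ≤ w)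
    {ρ : Multiset ℕ} (hρ : IsBarCore p ρ) {r : ℕ → ℕ}
    (h : IsConfiguration p w (charge p ρ) r) (hext : IsExternal p 0 ρ w) :
    IsConfiguration p w (charge p (SpinBlock.scopes p 0 ρ))
      fun i => SpinBlock.swapZero p (r i) := by
  have hpt := tNum_of_odd hp
  have hne : ∀ i, 0 < i → i ≤ tNum p → r i ≠ 1 := by
    intro i hi hit h1
    have h2 := h.le hi hit
    obtain rfl : i = 1 := by omega
    have h3 := h.charge_eq 1 hi hit
    rw [h1, Nat.mod_eq_of_lt (by omega), Nat.div_eq_of_lt (by omega)] at h3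
    exact not_isExternal_zero hp3 hp hw hρ (by simpa [maxCharge] using h3) hext
  have hcases := fun i hi hit => swapZero_cases hp3 (hne i hi hit)
  refine ⟨fun i hi hit => ?_, fun i hi hit => ?_, fun i j hi hij hjt => ?_, fun i hi hit => ?_⟩
  · have h1 := mod_pos_of_not_dvd (h.not_dvd i hi hit)
    rw [Nat.dvd_iff_mod_eq_zero]
    rcases hcases i hi hit with h2 | h2 | h2
    · omega
    · omega
    · rw [h2.2.2]
      omega
  · have h1 := h.lt_succ i hi hit
    have h2 := hcases i hi hit.le
    have h3 := hcases (i + 1) (by omega) hit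
    have h4 := h.mod_ne i (i + 1) hi (by omega) hit
    have a0 := mod_pos_of_not_dvd (h.not_dvd i hi hit.le)
    have b0 := mod_pos_of_not_dvd (h.not_dvd (i + 1) (by omega) hit)
    generalize r i = a at *
    generalize r (i + 1) = b at *
    have ha := Nat.mod_lt a hp.pos
    have hs : ∀ c, (c % p + 1 = p ∧ (c + 1) % p = 0) ∨
        (c % p + 1 < p ∧ (c + 1) % p = c % p + 1) := by
      intro c
      rcases (show c % p + 1 ≤ p from Nat.mod_lt c hp.pos).eq_or_lt with h | h
      · exact Or.inl ⟨h, Nat.mod_eq_zero_of_dvd (dvd_succ hp.pos (by omega))⟩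
      · exact Or.inr ⟨h, succ_mod h⟩
    have s1 := hs a
    have s2 := hs (a + 1)
    have hb1 : b = a + 1 → b % p = (a + 1) % p := fun h => by rw [h]
    have hb2 : b = a + 2 → b % p = (a + 1 + 1) % p := fun h => by rw [h]
    omega
  · have h1 := h.mod_ne i j hi hij hjt
    have h2 := hcases i hi (by omega)
    have h3 := hcases j (by omega) hjt
    have e2 : SpinBlock.swapZero p (r i) = r i → SpinBlock.swapZero p (r i) % p = r i % p :=
      fun h => by rw [h]
    have e3 : SpinBlock.swapZero p (r j) = r j → SpinBlock.swapZero p (r j) % p = r j % p :=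
      fun h => by rw [h]
    omega
  · have h1 := h.charge_eq i hi hit
    have hr0 := mod_pos_of_not_dvd (h.not_dvd i hi hit)
    have hr := Nat.mod_lt (r i) hp.pos
    rcases hcases i hi hit with h2 | h2 | h2
    · rw [h2.2.1, hρ.charge_scopes hp3 hp (Nat.zero_le _) (by omega) (by omega), reflect,
        if_pos rfl, reflectZero, if_neg (by omega), if_pos rfl]
      rw [h2.1, ← h2.2.2.1] at h1
      push_cast at h1 ⊢
      linarith
    · rw [h2.2.1, hρ.charge_scopes hp3 hp (Nat.zero_le _) (by omega) (by omega), reflect,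
        if_pos rfl, reflectZero, if_pos rfl, h2.2.2.1]
      rw [h2.1, charge_sub (by omega)] at h1
      push_cast at h1 ⊢
      linarith
    · rw [h2.2.2, hρ.charge_scopes hp3 hp (Nat.zero_le _) hr0 hr, reflect, if_pos rfl,
        reflectZero, if_neg h2.1, if_neg h2.2.1]
      exact h1

theorem exists_isConfiguration_of_reflTransGen {p w : ℕ} (hp3 : 3 ≤ p) (hp : Odd p) (hw : 1 ≤ w)
    {ρ σ : Multiset ℕ} (hρ : IsBarCore p ρ)
    (hx : ∀ j, 0 < j → j ≤ tNum p → charge p ρ j = maxCharge w j)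
    (h : Relation.ReflTransGen (AllowedAction p w) ρ σ) :
    IsBarCore p σ ∧ ∃ r, IsConfiguration p w (charge p σ) r := by
  induction h with
  | refl => exact ⟨hρ, id, isConfiguration_id hp hx⟩
  | tail _ hstep ih =>
    obtain ⟨hσ, r, hr⟩ := ih
    obtain ⟨i, hi, hext, rfl⟩ := hstep
    refine ⟨hσ.scopes hp3 hp hi, ?_⟩
    rcases Nat.eq_zero_or_pos i with rfl | hi0
    · exact ⟨_, hr.swapZero hp3 hp hw hσ hext⟩
    · exact ⟨_, hr.swapRunners hp3 hp hw hi0 hi hσ hext⟩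

/-- Completing the square: the subtracted term depends only on j, so comparing ranks means comparing
sums of squares. -/
theorem four_mul_runnerRank (p j : ℕ) (z : ℤ) :
    4 * p * runnerRank p j z = (2 * p * z - p + 2 * j) ^ 2 - ((p : ℤ) - 2 * j) ^ 2 := by
  rw [runnerRank]
  ring

/-- The residues r_i mod p represent each runner pair once, so the terms are matched by `min (r i %
p) (p - r i % p)`. When r_i lies on the upper runner p - j, antisymmetry only changes the sign
inside the square. -/
theorem IsConfiguration.sum_sq_eq {p w : ℕ} (hp : Odd p) {x : ℕ → ℤ} (hx : IsAntisymm p x)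
    {r : ℕ → ℕ} (h : IsConfiguration p w x r) :
    ∑ i ∈ Finset.Icc 1 (tNum p), (2 * p * maxCharge w i - p + 2 * (r i : ℤ)) ^ 2 =
      ∑ j ∈ Finset.Icc 1 (tNum p), (2 * p * x j - p + 2 * (j : ℤ)) ^ 2 := by
  have hpt := tNum_of_odd hp
  have hmaps : Set.MapsTo (fun i => min (r i % p) (p - r i % p))
      (Finset.Icc 1 (tNum p) : Finset ℕ) (Finset.Icc 1 (tNum p) : Finset ℕ) := by
    intro i hi
    rw [Finset.mem_coe, Finset.mem_Icc] at hi ⊢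
    have h1 := mod_pos_of_not_dvd (h.not_dvd i hi.1 hi.2)
    have h2 := Nat.mod_lt (r i) hp.pos
    dsimp only
    omega
  have hinj : Set.InjOn (fun i => min (r i % p) (p - r i % p))
      (Finset.Icc 1 (tNum p) : Finset ℕ) := by
    intro i hi j hj hij
    rw [Finset.mem_coe, Finset.mem_Icc] at hi hj
    simp only at hij
    have h1 := Nat.mod_lt (r i) hp.pos
    have h2 := Nat.mod_lt (r j) hp.pos
    rcases lt_trichotomy i j with h3 | h3 | h3
    · have := h.mod_ne i j hi.1 h3 hj.2
      omega
    · exact h3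
    · have := h.mod_ne j i hj.1 h3 hi.2
      omega
  refine Finset.sum_nbij (fun i => min (r i % p) (p - r i % p)) hmaps hinj
    (Finset.surjOn_of_injOn_of_card_le _ hmaps hinj le_rfl) fun i hi => ?_
  rw [Finset.mem_Icc] at hi
  have h0 := mod_pos_of_not_dvd (h.not_dvd i hi.1 hi.2)
  have h1 := Nat.mod_lt (r i) hp.pos
  have h2 := h.charge_eq i hi.1 hi.2
  have h3 : (r i : ℤ) = (r i % p : ℕ) + p * (r i / p : ℕ) := by
    exact_mod_cast (Nat.mod_add_div _ _).symm
  rw [h3]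
  generalize r i % p = s at *
  generalize r i / p = k at *
  rcases Nat.lt_or_ge (tNum p) s with hs | hs
  · rw [show min s (p - s) = p - s by omega, hx s h0 h1, h2]
    push_cast [h1.le]
    ring
  · rw [show min s (p - s) = s by omega, h2]
    ring

/-- Since M_i ≥ 1, the quantity 2 p M_i - p + 2 i is nonnegative, so replacing i by r_i ≥ i can only
increase its square. -/
theorem IsConfiguration.sum_runnerRank_le {p w : ℕ} (hp : Odd p) (hw : 1 ≤ w) {x : ℕ → ℤ}
    (hx : IsAntisymm p x) {r : ℕ → ℕ} (h : IsConfiguration p w x r) :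
    ∑ j ∈ Finset.Icc 1 (tNum p), runnerRank p j (maxCharge w j) ≤
      ∑ j ∈ Finset.Icc 1 (tNum p), runnerRank p j (x j) := by
  have hp0 : (0 : ℤ) < 4 * p := by have := hp.pos; positivity
  refine le_of_mul_le_mul_left ?_ hp0
  simp only [Finset.mul_sum, four_mul_runnerRank, Finset.sum_sub_distrib]
  rw [← h.sum_sq_eq hp hx]
  refine sub_le_sub_right (Finset.sum_le_sum fun i hi => ?_) _
  rw [Finset.mem_Icc] at hi
  have h1 : (i : ℤ) ≤ r i := by exact_mod_cast h.le hi.1 hi.2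
  have h2 : 1 ≤ maxCharge w i := by
    rw [maxCharge]
    have : (0 : ℤ) ≤ (w - 1) * ((i : ℤ) - 1) := mul_nonneg (by omega) (by omega)
    omega
  have h3 : (0 : ℤ) ≤ 2 * p * maxCharge w i - p + 2 * i := by
    have : (p : ℤ) * 1 ≤ p * maxCharge w i := mul_le_mul_of_nonneg_left h2 (by positivity)
    linarith
  exact pow_le_pow_left₀ h3 (by linarith) 2

theorem cannotBeReduced_of_charge_eq {p w : ℕ} (hp3 : 3 ≤ p) (hp : Odd p) (hw : 1 ≤ w)
    {ρ : Multiset ℕ} (hρ : IsBarCore p ρ)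
    (hx : ∀ j, 0 < j → j ≤ tNum p → charge p ρ j = maxCharge w j) : CannotBeReduced p w ρ := by
  intro σ h
  obtain ⟨hσ, r, hr⟩ := exists_isConfiguration_of_reflTransGen hp3 hp hw hρ hx h
  have h1 := hr.sum_runnerRank_le hp hw (isAntisymm_charge p σ)
  rw [← sum_runnerRank_congr hx, ← hρ.two_mul_sum hp, ← hσ.two_mul_sum hp] at h1
  rw [blockRank, blockRank]
  omega

/-! ### Core tuples -/

theorem IsBarCore.coreLen_eq {p : ℕ} (hp : Odd p) {ρ : Multiset ℕ} (h : IsBarCore p ρ) {j : ℕ}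
    (hj : 0 < j) (hjt : j ≤ tNum p) : coreLen p ρ j = (charge p ρ j).natAbs := by
  have hpt := tNum_of_odd hp
  have hsplit : (ρ.filter fun a => a % p = j ∨ a % p = p - j) =
      (ρ.filter fun a => a % p = j) + (ρ.filter fun a => a % p = p - j) := by
    rw [Multiset.filter_add_filter]
    have : (ρ.filter fun a => a % p = j ∧ a % p = p - j) = 0 := by
      rw [Multiset.filter_eq_nil]
      rintro a - ⟨h1, h2⟩
      omega
    rw [this, add_zero]
  rw [coreLen, hsplit, Multiset.card_add, h.card_filter hp hj (by omega),
    h.card_filter hp (r := p - j) (by omega) (by omega), charge_sub (by omega)]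
  omega

theorem IsBarCore.coreTuple_fst {p : ℕ} (hp : Odd p) {ρ : Multiset ℕ} (h : IsBarCore p ρ)
    (j : Fin (tNum p)) : (coreTuple p ρ j).1 = (charge p ρ (j + 1)).natAbs :=
  h.coreLen_eq hp (Nat.succ_pos _) j.2

theorem IsBarCore.eq_zero_of_charge_eq_zero {p : ℕ} (hp : Odd p) {ρ : Multiset ℕ}
    (h : IsBarCore p ρ) (h0 : ∀ j, 0 < j → j ≤ tNum p → charge p ρ j = 0) : ρ = 0 := by
  refine h.eq_of_charge_eq hp ⟨⟨by simp, Multiset.nodup_zero⟩, ?_⟩ fun j hj hjt => by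
    rw [h0 j hj hjt, charge_zero]
  rintro m (⟨b, n, -, -, h1, -⟩ | h1 | ⟨a, b, -, -, -, h1⟩) <;>
    exact Multiset.cons_ne_zero h1.symm

theorem mem_sortedLens {p : ℕ} {ρ : Multiset ℕ} {l : ℕ} :
    l ∈ sortedLens p ρ ↔ l ≠ 0 ∧ ∃ j, (coreTuple p ρ j).1 = l := by
  simp [sortedLens, and_comm]

theorem IsTame.exists_isLeast {p w : ℕ} (hp : Odd p) {ρ : Multiset ℕ} (hρ : IsBarCore p ρ)
    (h : IsTame (tNum p) w (charge p ρ)) (h0 : ρ ≠ 0) :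
    ∃ m, IsLeast {l : ℕ | l ≠ 0 ∧ ∃ j, (coreTuple p ρ j).1 = l} m ∧ m ≤ w := by
  set L := {l : ℕ | l ≠ 0 ∧ ∃ j, (coreTuple p ρ j).1 = l} with hL
  have hmem : ∀ j, 0 < j → j ≤ tNum p → charge p ρ j ≠ 0 → (charge p ρ j).natAbs ∈ L := by
    intro j hj hjt hne
    refine ⟨by simpa using hne, ⟨j - 1, by omega⟩, ?_⟩
    rw [hρ.coreTuple_fst hp]
    simp only
    rw [Nat.sub_add_cancel hj]
  have hex : ∃ j, 0 < j ∧ j ≤ tNum p ∧ charge p ρ j ≠ 0 := by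
    by_contra! hc
    exact h0 (hρ.eq_zero_of_charge_eq_zero hp hc)
  obtain ⟨j, hj, hjt, hne⟩ := hex
  have hleast : IsLeast L (sInf L) :=
    ⟨Nat.sInf_mem ⟨_, hmem j hj hjt hne⟩, fun l hl => Nat.sInf_le hl⟩
  refine ⟨sInf L, hleast, ?_⟩
  by_contra! hc
  -- If the least nonzero value exceeded w, the range from 1 to w would be a gap, and all charges
  -- would vanish.
  have := h.natAbs_le (a := 0) (b := w + 1) (by omega) (by omega) (fun k hk hkt => ?_) hj hjt
  · omega
  · by_cases hk0 : charge p ρ k = 0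
    · exact Or.inl (by simp [hk0])
    · exact Or.inr (hc.trans_le (hleast.2 (hmem k hk hkt hk0)))

theorem IsTame.sortedLens_sub_le {p w : ℕ} (hp : Odd p) {ρ : Multiset ℕ} (hρ : IsBarCore p ρ)
    (h : IsTame (tNum p) w (charge p ρ)) (k : ℕ) (hk0 : k < (sortedLens p ρ).length)
    (hk : k + 1 < (sortedLens p ρ).length) :
    ((sortedLens p ρ)[k + 1] : ℤ) - ((sortedLens p ρ)[k] : ℤ) ≤ (w : ℤ) - 1 := by
  by_contra! hc
  have hsorted : (sortedLens p ρ).SortedLE :=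
    (Multiset.pairwise_sort _ (· ≤ ·)).sortedLE
  have ha := mem_sortedLens.1 (List.getElem_mem (l := sortedLens p ρ) (n := k) hk0)
  have hb := mem_sortedLens.1 (List.getElem_mem hk)
  obtain ⟨hb0, j, hj⟩ := hb
  rw [hρ.coreTuple_fst hp] at hj
  -- For w = 0 two equal terms leave no gap to exploit, but then all charges vanish and the list has
  -- no entries. For w ≥ 1 the two terms bound a genuine gap.
  rcases Nat.eq_zero_or_pos w with rfl | hw
  · have := h.eq_zero (show 0 < (j : ℕ) + 1 by omega) j.2
    rw [this] at hj
    exact hb0 hj.symm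
  · have := h.natAbs_le (a := (sortedLens p ρ)[k]) (b := (sortedLens p ρ)[k + 1]) (by omega)
      (by omega) (fun i hi hit => ?_) (show 0 < (j : ℕ) + 1 by omega) j.2
    · omega
    · by_cases hi0 : (charge p ρ i).natAbs = 0
      · omega
      · have hmem : (charge p ρ i).natAbs ∈ sortedLens p ρ := by
          refine mem_sortedLens.2 ⟨hi0, ⟨i - 1, by omega⟩, ?_⟩
          rw [hρ.coreTuple_fst hp]
          simp only
          rw [Nat.sub_add_cancel hi]
        obtain ⟨n, hn, hn'⟩ := List.getElem_of_mem hmem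
        rw [← hn']
        rcases Nat.lt_or_ge k n with hkn | hkn
        · exact Or.inr (hsorted.getElem_le_getElem_of_le hkn)
        · exact Or.inl (hsorted.getElem_le_getElem_of_le hkn)

end SpinBlock

theorem mainTheorem3 (p : ℕ) (hp : p.Prime) (hp2 : p ≠ 2) (w : ℕ) :
    (∀ ρ : Multiset ℕ, SpinBlock.IsBarCore p ρ → SpinBlock.NoReducingAction p w ρ →
      -- (1) the minimum of the nonzero `ℓ_i`, if there are any, is at most `w`
      (ρ ≠ 0 → ∃ m : ℕ,
        IsLeast {l : ℕ | l ≠ 0 ∧ ∃ j, (SpinBlock.coreTuple p ρ j).1 = l} m ∧ m ≤ w) ∧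
      -- (2) consecutive terms of the sorted sequence of nonzero `ℓ_i` differ by at most `w - 1`
      (∀ (k : ℕ) (hk : k + 1 < (SpinBlock.sortedLens p ρ).length),
        ((SpinBlock.sortedLens p ρ)[k + 1] : ℤ) - ((SpinBlock.sortedLens p ρ)[k] : ℤ)
          ≤ (w : ℤ) - 1)) ∧
    -- (3) the block of maximal rank
    (1 ≤ w → ∃ ρw : Multiset ℕ, SpinBlock.IsBarCore p ρw ∧
      (∀ j, SpinBlock.coreTuple p ρw j = (w + (w - 1) * (j : ℕ), 0)) ∧
      SpinBlock.CannotBeReduced p w ρw ∧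
      ∀ σ : Multiset ℕ, SpinBlock.IsBarCore p σ → SpinBlock.NoReducingAction p w σ →
        SpinBlock.blockRank p σ w ≤ SpinBlock.blockRank p ρw w ∧
        (SpinBlock.blockRank p σ w = SpinBlock.blockRank p ρw w → σ = ρw)) := by
  have hodd : Odd p := hp.odd_of_ne_two hp2
  have hp3 : 3 ≤ p := by have := hp.two_le; omega
  have hpt := SpinBlock.tNum_of_odd hodd
  refine ⟨fun ρ hρ h => ?_, fun hw => ?_⟩
  · have ht := h.isTame hp3 hodd hρ
    exact ⟨ht.exists_isLeast hodd hρ, fun k hk =>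
      ht.sortedLens_sub_le hodd hρ k (Nat.lt_of_succ_lt hk) hk⟩
  · obtain ⟨ρ, hρ, hx⟩ := SpinBlock.exists_isBarCore_charge hodd (SpinBlock.maxCharge w)
    have hmax : ∀ j : ℕ, SpinBlock.maxCharge w (j + 1) = ((w + (w - 1) * j : ℕ) : ℤ) := by
      intro j
      rw [SpinBlock.maxCharge]
      push_cast [hw]
      ring
    refine ⟨ρ, hρ, fun j => Prod.ext ?_ ?_,
      SpinBlock.cannotBeReduced_of_charge_eq hp3 hodd hw hρ hx, fun σ hσ h => ?_⟩
    · rw [hρ.coreTuple_fst hodd, hx _ (Nat.succ_pos _) j.2, hmax, Int.natAbs_natCast]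
    · have h1 := hρ.card_filter hodd (Nat.succ_pos (j : ℕ)) (by omega)
      rw [hx _ (Nat.succ_pos _) j.2, hmax, Int.toNat_natCast] at h1
      simp only [SpinBlock.coreTuple, SpinBlock.coreEps]
      rw [if_neg]
      intro h2
      rw [Nat.succ_eq_add_one, h2, Multiset.card_zero] at h1
      omega
    · have h1 := (h.isTame hp3 hodd hσ).sum_runnerRank_le (p := p) (by omega) hw
      rw [← SpinBlock.sum_runnerRank_congr hx, ← hρ.two_mul_sum hodd, ← hσ.two_mul_sum hodd] at h1
      rw [SpinBlock.blockRank, SpinBlock.blockRank]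
      refine ⟨by omega, fun heq => hσ.eq_of_charge_eq hodd hρ fun j hj hjt => ?_⟩
      rw [h1.2 (by omega) j hj hjt, hx j hj hjt]
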